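/- **Setting.** Let $\widehat G=\mathrm{SL}(2,\mathbb C)^4$ act on $V=(\mathbb C^2)^{\otimes 4}$, with basis $e_{i_1i_2i_3i_4}=e_{i_1}\otimes e_{i_2}\otimes e_{i_3}\otimes e_{i_4}$ ($i_j\in\{0,1\}$), and let a bar denote entrywise (coordinatewise) complex conjugation; a point $p \in V$ is real if $\bar p=p$. Identify $V$ with the odd part $\mathfrak g_1$ of the $\mathbb Z/2\mathbb Z$-graded simple Lie algebra $\mathfrak g=\mathfrak g_0\oplus\mathfrak g_1$ of type $D_4$, where $\mathfrak g_0\cong\mathfrak{sl}(2,\mathbb C)^4$. Let $\mathfrak h\subset V$ be the Cartan subspace spanned by $$u_1=e_{0000}+e_{1111},\quad u_2=e_{0110}+e_{1001},\quad u_3=e_{0101}+e_{1010},\quad u_4=e_{0011}+e_{1100},$$ let $\Phi\subset\mathfrak h^*$ be the root system of $\mathfrak g$ with respect to $\mathfrak h$, and let $W\le\mathrm{GL}(\mathfrak h)$ be its Weyl group, generated by the reflections $s_\alpha(p)=p-\alpha(p)h_\alpha$, $\alpha\in\Phi$, where $h_\alpha\in[\mathfrak g_\alpha,\mathfrak g_{-\alpha}]$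 and $\alpha(h_\alpha)=2$. For $\Pi\subseteq\Phi$ put $$\mathfrak h_\Pi=\{p\in\mathfrak h:\alpha(p)=0\ \ \forall\alpha\in\Pi\},\qquad \mathfrak h_\Pi^\circ=\{p\in\mathfrak h_\Pi:\alpha(p)\neq0\ \ \forall\alpha\in\Phi\setminus\Pi\},$$ $$W_\Pi=\langle s_\alpha:\alpha\in\Pi\rangle,\qquad \Gamma_\Pi=N_W(W_\Pi)/W_\Pi.$$ The group $\Gamma_\Pi$ acts on $\mathfrak h_\Pi$, since $W_\Pi$ fixes $\mathfrak h_\Pi$ pointwise, and it carries the conjugation induced by complex conjugation on $\mathfrak h$. Fix $\Pi\subseteq\Phi$ such that $\mathcal C=\mathfrak h_\Pi^\circ$ is nonempty, and let $N_{\widehat G}(\mathcal C)=\{g\in\widehat G: gx\in\mathcal C\text{ for all }x\in\mathcal C\}$. Fix any $q\in\mathcal C$ and define $\varphi\colon N_{\widehat G}(\mathcal C)\to\Gamma_\Pi$ by $\varphi(g)=wW_\Pi$, where $w\in N_W(W_\Pi)$ is such that $w(q)=gq$. For a group $A$ with a conjugation $a\mapsto\bar a$ let $Z^1(A)=\{c\in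 A: c\bar c=1\}$ be the set of cocycles, and let $H^1(A)$ be the set of classes $[c]$ of cocycles under the equivalence $c\sim a c\bar a^{-1}$, $a\in A$; likewise $Z^1(N_{\widehat G}(\mathcal C))$ is the set of $n\in N_{\widehat G}(\mathcal C)$ with $n\bar n=1$. **Theorem 5.1.** Let $\gamma_1,\dots,\gamma_s\in Z^1(\Gamma_\Pi)$ with $H^1(\Gamma_\Pi)=\{[\gamma_1],\dots,[\gamma_s]\}$, and suppose that for each $i$ there is given $n_i\in Z^1(N_{\widehat G}(\mathcal C))$ with $\varphi(n_i)=\gamma_i$. Let $t\in\mathcal C$ and let $\mathcal O=\widehat G t$ be its orbit. Then $\mathcal O$ contains a real point if and only if there exist $q'\in\mathcal O\cap\mathcal C$ and $i\in\{1,\dots,s\}$ with $$\overline{q'}=\gamma_i^{-1}q'.$$ Moreover, whenever $q'\in\mathcal O\cap\mathcal C$ and $i$ satisfy this equation, there exists $g\in\widehat G$ with $g^{-1}\bar g=n_i$, and for every such $g$ the element $gq'$ is a real point of $\mathcal O$. -/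

import Mathlib

open scoped Kronecker

noncomputable section

namespace FourQubit

/-! ### Galois cohomology for a group with a conjugation -/

section Cohomology

variable {G : Type*} [Group G]

/-- The cocycles of `G` with respect to `σ`: the elements `c` with `c σ(c) = 1`. -/
def Z1 (σ : G →* G) : Set G := {c | c * σ c = 1}

/-- Equivalence of cocycles: `c' = a c σ(a)⁻¹` for some `a` in `G`. -/
def cocycleSetoid (σ : G →* G) : Setoid (Z1 σ) where
  r c c' := ∃ a : G, (c' : G) = a * c * (σ a)⁻¹
  iseqv :=
    { refl := fun c => ⟨1, by simp⟩
      symm := by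
        rintro c c' ⟨a, ha⟩
        exact ⟨a⁻¹, by rw [ha]; simp [mul_assoc]⟩
      trans := by
        rintro c c' c'' ⟨a, ha⟩ ⟨b, hb⟩
        exact ⟨b * a, by rw [hb, ha]; simp [mul_assoc]⟩ }

/-- The first cohomology set `H¹(G, σ)`. -/
def H1 (σ : G →* G) : Type _ := Quotient (cocycleSetoid σ)

/-- The class `[c]` in `H¹(G, σ)` of a cocycle `c`. -/
def H1.mk {σ : G →* G} (c : Z1 σ) : H1 σ := Quotient.mk (cocycleSetoid σ) c

end Cohomology

/-! ### Four-qubit states and the group `SL(2,ℂ)⁴` -/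

/-- The space `(ℂ²)^{⊗4}` in coordinates: the entry at row `(i₁, i₂)` and column `(i₃, i₄)` is the
coefficient of `e_{i₁} ⊗ e_{i₂} ⊗ e_{i₃} ⊗ e_{i₄}`. -/
abbrev Tensor4 : Type := Matrix (Fin 2 × Fin 2) (Fin 2 × Fin 2) ℂ

/-- The basis tensor `e_{i₁} ⊗ e_{i₂} ⊗ e_{i₃} ⊗ e_{i₄}`. -/
def e (i₁ i₂ i₃ i₄ : Fin 2) : Tensor4 := Matrix.single (i₁, i₂) (i₃, i₄) 1

/-- The group `SL(2,ℂ)⁴`. -/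
abbrev GHat : Type := Fin 4 → Matrix.SpecialLinearGroup (Fin 2) ℂ

/-- The action of `(A, B, C, D)` on `(ℂ²)^{⊗4}` by `A ⊗ B ⊗ C ⊗ D`. -/
instance : MulAction GHat Tensor4 where
  smul g x := ((g 0).1 ⊗ₖ (g 1).1) * x * ((g 2).1 ⊗ₖ (g 3).1).transpose
  one_smul x := by
    change ((1 : Matrix (Fin 2) (Fin 2) ℂ) ⊗ₖ (1 : Matrix (Fin 2) (Fin 2) ℂ)) * x *
      ((1 : Matrix (Fin 2) (Fin 2) ℂ) ⊗ₖ (1 : Matrix (Fin 2) (Fin 2) ℂ)).transpose = x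
    simp
  mul_smul g h x := by
    change (((g 0).1 * (h 0).1) ⊗ₖ ((g 1).1 * (h 1).1)) * x *
      (((g 2).1 * (h 2).1) ⊗ₖ ((g 3).1 * (h 3).1)).transpose =
      ((g 0).1 ⊗ₖ (g 1).1) * (((h 0).1 ⊗ₖ (h 1).1) * x * ((h 2).1 ⊗ₖ (h 3).1).transpose) *
      ((g 2).1 ⊗ₖ (g 3).1).transpose
    simp only [Matrix.mul_kronecker_mul, Matrix.transpose_mul, Matrix.mul_assoc]

theorem smul_def (g : GHat) (x : Tensor4) :
    g • x = ((g 0).1 ⊗ₖ (g 1).1) * x * ((g 2).1 ⊗ₖ (g 3).1).transpose := rfl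

/-- The coordinates of `g • x` are those of `(A ⊗ B ⊗ C ⊗ D) x`. -/
theorem smul_apply (g : GHat) (x : Tensor4) (i₁ i₂ i₃ i₄ : Fin 2) :
    (g • x) (i₁, i₂) (i₃, i₄) = ∑ j₁, ∑ j₂, ∑ j₃, ∑ j₄,
      (g 0).1 i₁ j₁ * (g 1).1 i₂ j₂ * (g 2).1 i₃ j₃ * (g 3).1 i₄ j₄ * x (j₁, j₂) (j₃, j₄) := by
  simp only [smul_def, Matrix.mul_apply, Fintype.sum_prod_type, Fin.sum_univ_two,
    Matrix.kroneckerMap_apply, Matrix.transpose_apply]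
  ring

/-- Complex conjugation on `SL(2,ℂ)⁴`. -/
def conjG : GHat →* GHat where
  toFun g i := Matrix.SpecialLinearGroup.map (starRingEnd ℂ) (g i)
  map_one' := by funext i; simp
  map_mul' g h := by funext i; simp

/-- Complex conjugation on `(ℂ²)^{⊗4}`. -/
def conjV (x : Tensor4) : Tensor4 := x.map (starRingEnd ℂ)

/-! ### The Lie algebra of type `D₄` and its `ℤ/2`-grading -/

/-- The symmetric bilinear form on `ℂ² ⊗ ℂ²` obtained as the tensor square of the standard
symplectic form of `ℂ²`. -/
def form4 : Matrix (Fin 2 × Fin 2) (Fin 2 × Fin 2) ℂ :=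
  (!![0, 1; -1, 0] : Matrix (Fin 2) (Fin 2) ℂ) ⊗ₖ (!![0, 1; -1, 0] : Matrix (Fin 2) (Fin 2) ℂ)

/-- A nondegenerate symmetric form on `ℂ⁸ = (ℂ² ⊗ ℂ²) ⊕ (ℂ² ⊗ ℂ²)`. -/
def form8 : Matrix ((Fin 2 × Fin 2) ⊕ (Fin 2 × Fin 2)) ((Fin 2 × Fin 2) ⊕ (Fin 2 × Fin 2)) ℂ :=
  Matrix.fromBlocks form4 0 0 (-form4)

/-- The simple Lie algebra `𝔤 = 𝔰𝔬(8,ℂ)` of type `D₄`. The block diagonal matrices form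
`𝔤₀ = 𝔰𝔬(4)² = 𝔰𝔩(2)⁴`, the block off-diagonal ones form `𝔤₁`. -/
abbrev so8 := skewAdjointMatricesLieSubalgebra form8

theorem form4_transpose : form4.transpose = form4 := by
  ext ⟨i, j⟩ ⟨k, l⟩
  fin_cases i <;> fin_cases j <;> fin_cases k <;> fin_cases l <;> simp [form4]

theorem form4_mul_form4 : form4 * form4 = 1 := by
  rw [form4, ← Matrix.mul_kronecker_mul]
  ext ⟨i, j⟩ ⟨k, l⟩
  fin_cases i <;> fin_cases j <;> fin_cases k <;> fin_cases l <;> simp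

/-- The identification of `(ℂ²)^{⊗4}` with the odd part `𝔤₁` of `𝔤`. -/
def toG : Tensor4 →ₗ[ℂ] so8 where
  toFun x := ⟨Matrix.fromBlocks 0 (x * form4) (x.transpose * form4) 0, by
    rw [mem_skewAdjointMatricesLieSubalgebra, mem_skewAdjointMatricesSubmodule,
      Matrix.IsSkewAdjoint, Matrix.IsAdjointPair, form8, Matrix.fromBlocks_neg,
      Matrix.fromBlocks_transpose, Matrix.fromBlocks_multiply, Matrix.fromBlocks_multiply]
    simp only [Matrix.transpose_mul, Matrix.transpose_transpose, form4_transpose]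
    simp [Matrix.mul_assoc]⟩
  map_add' x y := by
    apply Subtype.ext
    simp [Matrix.add_mul, Matrix.fromBlocks_add]
  map_smul' c x := by
    apply Subtype.ext
    simp [Matrix.fromBlocks_smul]

/-- Under the identification, `(A, B, C, D)` acts on `𝔤₁` through conjugation by the block diagonal
matrix with blocks `A ⊗ B` and `C ⊗ D`, which preserves the form. -/
theorem toG_smul (g : GHat) (x : Tensor4) :
    (toG (g • x)).1 * Matrix.fromBlocks ((g 0).1 ⊗ₖ (g 1).1) 0 0 ((g 2).1 ⊗ₖ (g 3).1) =
      Matrix.fromBlocks ((g 0).1 ⊗ₖ (g 1).1) 0 0 ((g 2).1 ⊗ₖ (g 3).1) * (toG x).1 := by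
  have h2 : ∀ A : Matrix.SpecialLinearGroup (Fin 2) ℂ,
      A.1.transpose * !![0, 1; -1, 0] * A.1 = (!![0, 1; -1, 0] : Matrix (Fin 2) (Fin 2) ℂ) := by
    intro A
    have hd := A.2
    rw [Matrix.det_fin_two] at hd
    ext i j
    fin_cases i <;> fin_cases j <;>
      simp [Matrix.mul_apply, Fin.sum_univ_two] <;>
      first
        | (ring; done)
        | linear_combination hd
        | linear_combination -hd
  have h4 : ∀ A B : Matrix.SpecialLinearGroup (Fin 2) ℂ,
      (A.1 ⊗ₖ B.1).transpose * (form4 * (A.1 ⊗ₖ B.1)) = form4 := by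
    intro A B
    rw [← Matrix.mul_assoc, form4, ← Matrix.kroneckerMap_transpose, ← Matrix.mul_kronecker_mul,
      ← Matrix.mul_kronecker_mul, h2, h2]
  simp only [toG, LinearMap.coe_mk, AddHom.coe_mk, Matrix.fromBlocks_multiply, smul_def,
    Matrix.transpose_mul, Matrix.transpose_transpose, Matrix.mul_assoc, h4]
  simp

/-! ### The Cartan subspace, roots, and Weyl group -/

/-- The Cartan subspace spanned by `u₁, u₂, u₃, u₄`. -/
def cartan : Submodule ℂ Tensor4 :=
  Submodule.span ℂ {e 0 0 0 0 + e 1 1 1 1, e 0 1 1 0 + e 1 0 0 1,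
    e 0 1 0 1 + e 1 0 1 0, e 0 0 1 1 + e 1 1 0 0}

/-- The root space `𝔤_α = {x ∈ 𝔤 : [p, x] = α(p) x for all p ∈ 𝔥}`. -/
def rootSpace (α : Module.Dual ℂ cartan) : Submodule ℂ so8 where
  carrier := {x | ∀ p : cartan, ⁅toG p, x⁆ = α p • x}
  add_mem' := by
    intro x y hx hy p
    rw [lie_add, hx p, hy p, smul_add]
  zero_mem' := by intro p; simp
  smul_mem' := by
    intro c x hx p
    rw [lie_smul, hx p, smul_comm]

/-- The root system `Φ` of `𝔤` with respect to `𝔥`. -/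
def roots : Set (Module.Dual ℂ cartan) := {α | α ≠ 0 ∧ rootSpace α ≠ ⊥}

/-- `c` is the element `h_α` of `𝔥`: it lies in `[𝔤_α, 𝔤_{-α}]` and `α(c) = 2`. -/
def IsCoroot (α : Module.Dual ℂ cartan) (c : cartan) : Prop :=
  α c = 2 ∧ toG c ∈ Submodule.span ℂ
    {z : so8 | ∃ x ∈ rootSpace α, ∃ y ∈ rootSpace (-α), z = ⁅x, y⁆}

/-- The subgroup `W_Π` generated by the reflections `s_α : p ↦ p - α(p) h_α` with `α ∈ Π`. -/
def weylSub (P : Set (Module.Dual ℂ cartan)) : Subgroup (cartan ≃ₗ[ℂ] cartan) :=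
  Subgroup.closure {s | ∃ α ∈ P, ∃ c, IsCoroot α c ∧ ∀ p, s p = p - α p • c}

/-- The Weyl group `W`. -/
def weyl : Subgroup (cartan ≃ₗ[ℂ] cartan) := weylSub roots

/-- The normaliser `N_W(W_Π)`. -/
def weylNormalizer (P : Set (Module.Dual ℂ cartan)) : Subgroup (cartan ≃ₗ[ℂ] cartan) :=
  weyl ⊓ Subgroup.normalizer (weylSub P : Set (cartan ≃ₗ[ℂ] cartan))

instance (P : Set (Module.Dual ℂ cartan)) :
    ((weylSub P).subgroupOf (weylNormalizer P)).Normal :=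
  Subgroup.normal_subgroupOf_of_le_normalizer inf_le_right

/-- The group `Γ_Π = N_W(W_Π) / W_Π`. -/
abbrev Gam (P : Set (Module.Dual ℂ cartan)) : Type :=
  weylNormalizer P ⧸ (weylSub P).subgroupOf (weylNormalizer P)

/-- The subspace `𝔥_Π` of `𝔥` where all elements of `Π` vanish. -/
def hSub (P : Set (Module.Dual ℂ cartan)) : Submodule ℂ cartan where
  carrier := {p | ∀ α ∈ P, α p = 0}
  add_mem' := by
    intro x y hx hy α hα
    rw [map_add, hx α hα, hy α hα, add_zero]
  zero_mem' := by intro α _; simp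
  smul_mem' := by
    intro c x hx α hα
    rw [map_smul, hx α hα, smul_zero]

/-- The set `𝔥_Π°` of the elements of `𝔥_Π` where no element of `Φ \ Π` vanishes. -/
def hReg (P : Set (Module.Dual ℂ cartan)) : Set (hSub P) :=
  {p | ∀ α ∈ roots \ P, α (p : cartan) ≠ 0}

/-- `𝔥_Π°` as a subset of `(ℂ²)^{⊗4}`. -/
def component (P : Set (Module.Dual ℂ cartan)) : Set Tensor4 :=
  (fun p : hSub P => ((p : cartan) : Tensor4)) '' hReg P

theorem weylSub_fixes {P : Set (Module.Dual ℂ cartan)} {w : cartan ≃ₗ[ℂ] cartan}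
    (hw : w ∈ weylSub P) {x : cartan} (hx : x ∈ hSub P) : w x = x := by
  induction hw using Subgroup.closure_induction with
  | mem s hs =>
    obtain ⟨α, hα, c, -, h⟩ := hs
    rw [h, hx α hα, zero_smul, sub_zero]
  | one => rfl
  | mul a b _ _ ha hb => rw [LinearEquiv.mul_apply, hb, ha]
  | inv a _ ha =>
    conv_lhs => rw [← ha]
    exact a.symm_apply_apply x

/-- The action of `Γ_Π` on the elements of `𝔥_Π`: a coset `w W_Π` maps `x` to `w x`. -/
def gamAct {P : Set (Module.Dual ℂ cartan)} (γ : Gam P) (x : hSub P) : cartan :=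
  Quotient.liftOn' γ (fun w => w.1 (x : cartan)) (by
    intro a b hab
    have h := QuotientGroup.leftRel_apply.mp hab
    rw [Subgroup.mem_subgroupOf] at h
    have h' := weylSub_fixes h x.2
    have h'' := congrArg a.1 h'
    change a.1 (a.1.symm (b.1 x)) = a.1 x at h''
    rw [LinearEquiv.apply_symm_apply] at h''
    exact h''.symm)

/-! ### Normaliser of the component and the map `φ` -/

/-- The set `N(𝒞)` of all `g` in `SL(2,ℂ)⁴` that map `𝒞 = 𝔥_Π°` into itself. -/
def normC (P : Set (Module.Dual ℂ cartan)) : Set GHat :=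
  {g | ∀ x ∈ component P, g • x ∈ component P}

/-- The map `φ : N(𝒞) → Γ_Π` with respect to a base point `q`: it sends `g` to `w W_Π`, where
`w ∈ N_W(W_Π)` is an element with `w(q) = g q`. -/
def phi {P : Set (Module.Dual ℂ cartan)} (q : hSub P) (g : normC P) : Gam P :=
  QuotientGroup.mk (Classical.epsilon fun w : weylNormalizer P =>
    ((w.1 (q : cartan) : cartan) : Tensor4) = g.1 • ((q : cartan) : Tensor4))

/-! ### Complex conjugation on `Γ_Π` -/

theorem conjV_conjV (x : Tensor4) : conjV (conjV x) = x := by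
  ext i j; simp [conjV]

theorem conjV_add (x y : Tensor4) : conjV (x + y) = conjV x + conjV y := by
  ext i j; simp [conjV]

theorem conjV_smul (c : ℂ) (x : Tensor4) : conjV (c • x) = starRingEnd ℂ c • conjV x := by
  ext i j; simp [conjV]

theorem conjV_e (a b c d : Fin 2) : conjV (e a b c d) = e a b c d := by
  ext i j
  simp only [conjV, e, Matrix.map_apply, Matrix.single_apply]
  split_ifs <;> simp

theorem conjV_mem_cartan {x : Tensor4} (hx : x ∈ cartan) : conjV x ∈ cartan := by
  induction hx using Submodule.span_induction with
  | mem y hy =>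
    have : conjV y = y := by
      rcases hy with rfl | rfl | rfl | rfl <;> simp only [conjV_add, conjV_e]
    rw [this]
    exact Submodule.subset_span hy
  | zero =>
    have : conjV 0 = 0 := by ext i j; simp [conjV]
    rw [this]; exact Submodule.zero_mem _
  | add y z _ _ h1 h2 => rw [conjV_add]; exact Submodule.add_mem _ h1 h2
  | smul c y _ h => rw [conjV_smul]; exact Submodule.smul_mem _ _ h

/-- Complex conjugation on `𝔥`. -/
def conjH (p : cartan) : cartan := ⟨conjV p, conjV_mem_cartan p.2⟩

theorem conjH_conjH (p : cartan) : conjH (conjH p) = p := Subtype.ext (conjV_conjV _)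

theorem conjH_add (p q : cartan) : conjH (p + q) = conjH p + conjH q :=
  Subtype.ext (conjV_add _ _)

theorem conjH_sub (p q : cartan) : conjH (p - q) = conjH p - conjH q := by
  rw [eq_sub_iff_add_eq, ← conjH_add, sub_add_cancel]

theorem conjH_smul (c : ℂ) (p : cartan) : conjH (c • p) = starRingEnd ℂ c • conjH p :=
  Subtype.ext (conjV_smul _ _)

/-- Complex conjugation on `GL(𝔥)`: the map `w` goes to `p ↦ conj (w (conj p))`. -/
def conjGL : (cartan ≃ₗ[ℂ] cartan) →* (cartan ≃ₗ[ℂ] cartan) where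
  toFun w :=
    { toFun := fun p => conjH (w (conjH p))
      invFun := fun p => conjH (w.symm (conjH p))
      map_add' := by intro p q; simp only [conjH_add, map_add]
      map_smul' := by
        intro c p
        simp only [conjH_smul, map_smul, RingHom.id_apply, Complex.conj_conj]
      left_inv := by intro p; simp [conjH_conjH]
      right_inv := by intro p; simp [conjH_conjH] }
  map_one' := by
    ext1 p
    exact conjH_conjH p
  map_mul' v w := by
    ext1 p
    change conjH (v (w (conjH p))) = conjH (v (conjH (conjH (w (conjH p)))))
    rw [conjH_conjH]

theorem conjGL_apply (w : cartan ≃ₗ[ℂ] cartan) (p : cartan) :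
    conjGL w p = conjH (w (conjH p)) := rfl

theorem cartan_comm {p : Tensor4} (hp : p ∈ cartan) : p * form4 = form4 * p := by
  induction hp using Submodule.span_induction with
  | mem y hy =>
    rcases hy with rfl | rfl | rfl | rfl <;>
    · ext ⟨i, j⟩ ⟨k, l⟩
      fin_cases i <;> fin_cases j <;> fin_cases k <;> fin_cases l <;>
        simp [form4, e, Matrix.mul_apply, Matrix.single_apply]
  | zero => simp
  | add y z _ _ h1 h2 => rw [Matrix.add_mul, Matrix.mul_add, h1, h2]
  | smul c y _ h => rw [Matrix.smul_mul, Matrix.mul_smul, h]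

theorem form4_map : form4.map (starRingEnd ℂ) = form4 := by
  ext ⟨i, j⟩ ⟨k, l⟩
  fin_cases i <;> fin_cases j <;> fin_cases k <;> fin_cases l <;> simp [form4]

theorem form8_map : form8.map (starRingEnd ℂ) = form8 := by
  have h : (-form4).map (starRingEnd ℂ) = -form4 := by
    conv_rhs => rw [← form4_map]
    ext i j; simp
  rw [form8, Matrix.fromBlocks_map, form4_map, h]
  simp

theorem toG_conjTranspose (p : cartan) :
    (toG (p : Tensor4)).1.conjTranspose = (toG (conjH p : Tensor4)).1 := by
  have hJ : form4.conjTranspose = form4 := by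
    rw [Matrix.conjTranspose, form4_transpose]; exact form4_map
  have h1 : (p : Tensor4).conjTranspose.transpose = conjV p := by ext i j; simp [conjV]
  have h2 : (p : Tensor4).transpose.conjTranspose = conjV p := by ext i j; simp [conjV]
  have h3 : (p : Tensor4).conjTranspose = (conjV p).transpose := by ext i j; simp [conjV]
  have h4 := cartan_comm (conjH p).2
  have h5 := congrArg Matrix.transpose h4
  rw [Matrix.transpose_mul, Matrix.transpose_mul, form4_transpose] at h5
  simp only [toG, LinearMap.coe_mk, AddHom.coe_mk, Matrix.fromBlocks_conjTranspose,
    Matrix.conjTranspose_mul, hJ, h2, h3]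
  change Matrix.fromBlocks _ (form4 * (conjH p : Tensor4))
    (form4 * (conjH p : Tensor4).transpose) _ = _
  rw [← h4, h5]
  simp

theorem lie_val (x y : so8) : (⁅x, y⁆ : so8).1 = x.1 * y.1 - y.1 * x.1 := rfl

open scoped ComplexOrder in
theorem dual_conj {α : Module.Dual ℂ cartan} (hα : rootSpace α ≠ ⊥) (p : cartan) :
    α (conjH p) = starRingEnd ℂ (α p) := by
  obtain ⟨x, hx, hx0⟩ := (Submodule.ne_bot_iff _).mp hα
  have h1 := congrArg Subtype.val (hx p)
  have h2 := congrArg Subtype.val (hx (conjH p))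
  rw [lie_val] at h1 h2
  rw [← toG_conjTranspose] at h2
  change _ = α p • x.1 at h1
  change _ = α (conjH p) • x.1 at h2
  have h3 := congrArg (fun M => (M.conjTranspose * x.1).trace) h1
  have h4 := congrArg (fun M => (x.1.conjTranspose * M).trace) h2
  have h5 : (x.1.conjTranspose * x.1).trace ≠ 0 := by
    rw [Ne, Matrix.trace_conjTranspose_mul_self_eq_zero_iff]
    exact fun h => hx0 (Subtype.ext h)
  simp only [Matrix.conjTranspose_sub, Matrix.conjTranspose_mul, Matrix.conjTranspose_smul,
    Matrix.sub_mul, Matrix.mul_sub, Matrix.trace_sub, Matrix.smul_mul, Matrix.mul_smul,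
    Matrix.trace_smul, smul_eq_mul] at h3 h4
  rw [Matrix.mul_assoc, Matrix.mul_assoc, Matrix.trace_mul_comm (toG (p : Tensor4)).1.conjTranspose,
    Matrix.mul_assoc] at h3
  exact mul_right_cancel₀ h5 (h4.symm.trans h3)

/-- Complex conjugation on `𝔤`. -/
def conjS (x : so8) : so8 := ⟨x.1.map (starRingEnd ℂ), by
  have h := x.2
  rw [mem_skewAdjointMatricesLieSubalgebra, mem_skewAdjointMatricesSubmodule,
    Matrix.IsSkewAdjoint, Matrix.IsAdjointPair] at h ⊢
  have h' := congrArg (fun M => M.map (starRingEnd ℂ)) h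
  have hn : (-x.1).map (starRingEnd ℂ) = -(x.1.map (starRingEnd ℂ)) := by ext i j; simp
  simp only [Matrix.map_mul, form8_map, hn] at h'
  exact h'⟩

theorem conjS_add (x y : so8) : conjS (x + y) = conjS x + conjS y := by
  apply Subtype.ext; ext i j; simp [conjS]

theorem conjS_smul (c : ℂ) (x : so8) : conjS (c • x) = starRingEnd ℂ c • conjS x := by
  apply Subtype.ext; ext i j; simp [conjS]

theorem conjS_lie (x y : so8) : conjS ⁅x, y⁆ = ⁅conjS x, conjS y⁆ := by
  apply Subtype.ext
  have hs : ∀ A B : Matrix ((Fin 2 × Fin 2) ⊕ (Fin 2 × Fin 2)) ((Fin 2 × Fin 2) ⊕ (Fin 2 × Fin 2)) ℂ,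
    (A - B).map (starRingEnd ℂ) = A.map (starRingEnd ℂ) - B.map (starRingEnd ℂ) := by
    intro A B; ext i j; simp
  simp only [conjS, lie_val, hs, Matrix.map_mul]

theorem conjS_toG (p : Tensor4) : conjS (toG p) = toG (conjV p) := by
  apply Subtype.ext
  simp only [conjS, toG, LinearMap.coe_mk, AddHom.coe_mk, Matrix.fromBlocks_map, Matrix.map_mul,
    form4_map, conjV, Matrix.transpose_map]
  simp

theorem conjS_mem_rootSpace {α : Module.Dual ℂ cartan}
    (hα : ∀ p, α (conjH p) = starRingEnd ℂ (α p)) {x : so8} (hx : x ∈ rootSpace α) :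
    conjS x ∈ rootSpace α := by
  intro p
  have h := congrArg conjS (hx (conjH p))
  rw [conjS_lie, conjS_smul, conjS_toG, hα, Complex.conj_conj] at h
  change ⁅toG (conjH (conjH p) : Tensor4), _⁆ = _ at h
  rwa [conjH_conjH] at h

theorem IsCoroot.rootSpace_ne_bot {α : Module.Dual ℂ cartan} {c : cartan} (h : IsCoroot α c) :
    rootSpace α ≠ ⊥ := by
  intro hbot
  have h0 : toG (c : Tensor4) = 0 := by
    have h2 := h.2
    have : Submodule.span ℂ
        {z : so8 | ∃ x ∈ rootSpace α, ∃ y ∈ rootSpace (-α), z = ⁅x, y⁆} ≤ ⊥ := by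
      rw [Submodule.span_le]
      rintro z ⟨x, hx, y, -, rfl⟩
      rw [hbot, Submodule.mem_bot] at hx
      simp [hx]
    exact (Submodule.mem_bot ℂ).mp (this h2)
  have h1 : (c : Tensor4) = 0 := by
    have h3 := congrArg (fun z : so8 => z.1.toBlocks₁₂) h0
    change (Matrix.fromBlocks 0 ((c : Tensor4) * form4) _ 0).toBlocks₁₂ = 0 at h3
    rw [Matrix.toBlocks_fromBlocks₁₂] at h3
    have h4 := congrArg (fun M => M * form4) h3
    simpa [Matrix.mul_assoc, form4_mul_form4] using h4
  have h2 : c = 0 := Subtype.ext h1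
  have h4 := h.1
  rw [h2, map_zero] at h4
  norm_num at h4

theorem IsCoroot.conj {α : Module.Dual ℂ cartan} {c : cartan} (h : IsCoroot α c) :
    IsCoroot α (conjH c) := by
  have hα := dual_conj h.rootSpace_ne_bot
  have hα' : ∀ p, (-α) (conjH p) = starRingEnd ℂ ((-α) p) := by
    intro p; simp [hα]
  refine ⟨by rw [hα, h.1]; exact map_ofNat _ 2, ?_⟩
  have key : ∀ z ∈ Submodule.span ℂ
      {z : so8 | ∃ x ∈ rootSpace α, ∃ y ∈ rootSpace (-α), z = ⁅x, y⁆},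
      conjS z ∈ Submodule.span ℂ
        {z : so8 | ∃ x ∈ rootSpace α, ∃ y ∈ rootSpace (-α), z = ⁅x, y⁆} := by
    intro z hz
    induction hz using Submodule.span_induction with
    | mem z hz =>
      obtain ⟨x, hx, y, hy, rfl⟩ := hz
      exact Submodule.subset_span
        ⟨_, conjS_mem_rootSpace hα hx, _, conjS_mem_rootSpace hα' hy, conjS_lie x y⟩
    | zero =>
      have : conjS 0 = 0 := by apply Subtype.ext; ext i j; simp [conjS]
      rw [this]; exact Submodule.zero_mem _
    | add y z _ _ h1 h2 => rw [conjS_add]; exact Submodule.add_mem _ h1 h2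
    | smul c y _ h => rw [conjS_smul]; exact Submodule.smul_mem _ _ h
  have := key _ h.2
  rwa [conjS_toG] at this

theorem conjGL_conjGL (w : cartan ≃ₗ[ℂ] cartan) : conjGL (conjGL w) = w := by
  ext1 p
  simp only [conjGL_apply, conjH_conjH]

theorem conjGL_mem_weylSub {P : Set (Module.Dual ℂ cartan)} {w : cartan ≃ₗ[ℂ] cartan}
    (hw : w ∈ weylSub P) : conjGL w ∈ weylSub P := by
  induction hw using Subgroup.closure_induction with
  | mem s hs =>
    obtain ⟨α, hα, c, hc, h⟩ := hs
    refine Subgroup.subset_closure ⟨α, hα, conjH c, hc.conj, fun p => ?_⟩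
    rw [conjGL_apply, h, dual_conj hc.rootSpace_ne_bot, conjH_sub, conjH_smul, conjH_conjH,
      Complex.conj_conj]
  | one => rw [map_one]; exact Subgroup.one_mem _
  | mul a b _ _ ha hb => rw [map_mul]; exact Subgroup.mul_mem _ ha hb
  | inv a _ ha => rw [map_inv]; exact Subgroup.inv_mem _ ha

theorem conjGL_mem_weylNormalizer {P : Set (Module.Dual ℂ cartan)} {w : cartan ≃ₗ[ℂ] cartan}
    (hw : w ∈ weylNormalizer P) : conjGL w ∈ weylNormalizer P := by
  refine ⟨conjGL_mem_weylSub hw.1, ?_⟩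
  have h := Subgroup.mem_normalizer_iff.mp hw.2
  refine Subgroup.mem_normalizer_iff.mpr fun v => ⟨fun hv => ?_, fun hv => ?_⟩
  · have := conjGL_mem_weylSub ((h _).mp (conjGL_mem_weylSub hv))
    simpa only [map_mul, map_inv, conjGL_conjGL] using this
  · have h1 := conjGL_mem_weylSub hv
    simp only [map_mul, map_inv, conjGL_conjGL] at h1
    have := conjGL_mem_weylSub ((h _).mpr h1)
    rwa [conjGL_conjGL] at this

/-- Complex conjugation on `N_W(W_Π)`. -/
def conjN (P : Set (Module.Dual ℂ cartan)) : weylNormalizer P →* weylNormalizer P where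
  toFun w := ⟨conjGL w.1, conjGL_mem_weylNormalizer w.2⟩
  map_one' := Subtype.ext (map_one conjGL)
  map_mul' v w := Subtype.ext (map_mul conjGL v.1 w.1)

/-- Complex conjugation on `Γ_Π = N_W(W_Π) / W_Π`. -/
def conjGam (P : Set (Module.Dual ℂ cartan)) : Gam P →* Gam P :=
  QuotientGroup.map _ _ (conjN P) (by
    intro w hw
    exact conjGL_mem_weylSub hw)

end FourQubit

end

open scoped Kronecker

noncomputable section

namespace FourQubit

/-! If `g • t` is real, then `conj t` lies in the orbit of `t`. Two points of 𝒞 in one orbit differ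
by an element of Γ_Π, so `conj t = c t` with `c` in Γ_Π. Conjugating once more and using that Γ_Π
acts freely on 𝒞 gives `c̄ c = 1`. Hence `c⁻¹` is a cocycle and `c⁻¹ = a γ_i ā⁻¹` for some `a` and
`i`; the point `q' = a⁻¹ t` then satisfies `conj q' = γ_i⁻¹ q'`, and it stays in the orbit because
Weyl group elements are induced by SL(2,ℂ)⁴. Conversely, the vanishing of H¹ for SL(2,ℂ) gives `g`
with `g⁻¹ ḡ = n_i`, and `conj (g q') = g n_i γ_i⁻¹ q' = g q'` because `n_i` acts on 𝒞 as `γ_i`.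

The facts about 𝔥 are obtained in coordinates in which the roots are ±ε_k ± ε_l and W is the group
of even signed permutations (`evenSigned_eq_weyl`). Stabilisers generated by reflections
(`mem_weylSub_of_fixes`) give the free action `gamAct_injective`. Explicit matrices give
`weyl_le_realised`, and comparing polynomial invariants gives the converse
`exists_mem_weyl_of_smul_eq`. A covering argument shows that an element of N(𝒞) acts on all of 𝔥_Π
through φ (`smul_eq_gamAct_phi`). Hilbert 90 is `exists_inv_mul_conj_eq`. -/

/-! ### Coordinates on the Cartan subspace -/

/-- The (unnormalised) Bell basis of `ℂ² ⊗ ℂ²`, as the columns of a matrix. -/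
def bell : Matrix (Fin 2 × Fin 2) (Fin 4) ℂ :=
  Matrix.of fun p => !![1, 1, 0, 0; 0, 0, 1, 1; 0, 0, 1, -1; 1, -1, 0, 0] (finProdFinEquiv p)

/-- The eigenvalues of `form4` on the Bell basis. -/
def bellSign : Fin 4 → ℂ := ![1, -1, -1, 1]

theorem bellSign_mul_self (k : Fin 4) : bellSign k * bellSign k = 1 := by
  fin_cases k <;> simp [bellSign]

theorem bell_transpose_mul_bell : bell.transpose * bell = (2 : ℂ) • 1 := by
  ext i j
  fin_cases i <;> fin_cases j <;>
    simp [bell, Matrix.mul_apply, Fintype.sum_prod_type, finProdFinEquiv] <;> norm_num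

theorem bell_mul_bell_transpose : bell * bell.transpose = (2 : ℂ) • 1 := by
  ext ⟨i, j⟩ ⟨k, l⟩
  fin_cases i <;> fin_cases j <;> fin_cases k <;> fin_cases l <;>
    simp [bell, Matrix.mul_apply, Fin.sum_univ_four, finProdFinEquiv] <;> norm_num

theorem form4_mul_bell : form4 * bell = bell * Matrix.diagonal bellSign := by
  ext ⟨i, j⟩ k
  fin_cases i <;> fin_cases j <;> fin_cases k <;>
    simp [bell, form4, bellSign, Matrix.mul_diagonal, Matrix.mul_apply (M := _ ⊗ₖ _),
      Fintype.sum_prod_type, finProdFinEquiv]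

/-- The coordinates, as a linear map on all tensors. -/
def coordMap : Tensor4 →ₗ[ℂ] (Fin 4 → ℂ) where
  -- For `p` in 𝔥 these are the eigenvalues of `p * form4` on the four Bell vectors, read off from
  -- the rows (0,0) and (0,1) of `p`.
  toFun p := ![p (0, 0) (0, 0) + p (0, 0) (1, 1), p (0, 0) (1, 1) - p (0, 0) (0, 0),
    -(p (0, 1) (0, 1) + p (0, 1) (1, 0)), p (0, 1) (0, 1) - p (0, 1) (1, 0)]
  map_add' p q := by
    ext i; fin_cases i <;> simp <;> ring
  map_smul' c p := by
    ext i; fin_cases i <;> simp <;> ring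

/-- The tensor in the Cartan subspace with given coordinates. -/
def ofCoord : (Fin 4 → ℂ) →ₗ[ℂ] Tensor4 where
  toFun f := ((f 0 - f 1) / 2) • (e 0 0 0 0 + e 1 1 1 1) +
    (-(f 2 + f 3) / 2) • (e 0 1 1 0 + e 1 0 0 1) +
    ((f 3 - f 2) / 2) • (e 0 1 0 1 + e 1 0 1 0) + ((f 0 + f 1) / 2) • (e 0 0 1 1 + e 1 1 0 0)
  map_add' p q := by simp only [Pi.add_apply]; module
  map_smul' c p := by simp only [Pi.smul_apply, RingHom.id_apply, smul_eq_mul]; module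

theorem ofCoord_apply (f : Fin 4 → ℂ) :
    ofCoord f = ((f 0 - f 1) / 2) • (e 0 0 0 0 + e 1 1 1 1) +
    (-(f 2 + f 3) / 2) • (e 0 1 1 0 + e 1 0 0 1) +
    ((f 3 - f 2) / 2) • (e 0 1 0 1 + e 1 0 1 0) +
    ((f 0 + f 1) / 2) • (e 0 0 1 1 + e 1 1 0 0) := rfl

theorem ofCoord_mem (f : Fin 4 → ℂ) : ofCoord f ∈ cartan := by
  have h : ∀ y ∈ ({e 0 0 0 0 + e 1 1 1 1, e 0 1 1 0 + e 1 0 0 1,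
    e 0 1 0 1 + e 1 0 1 0, e 0 0 1 1 + e 1 1 0 0} : Set Tensor4), y ∈ cartan :=
    fun y hy => Submodule.subset_span hy
  rw [ofCoord_apply]
  refine cartan.add_mem (cartan.add_mem (cartan.add_mem ?_ ?_) ?_) ?_ <;>
    exact cartan.smul_mem _ (h _ (by simp))

theorem coordMap_ofCoord (f : Fin 4 → ℂ) : coordMap (ofCoord f) = f := by
  ext i
  fin_cases i <;> simp [coordMap, ofCoord_apply, e] <;> ring

theorem ofCoord_coordMap {p : Tensor4} (hp : p ∈ cartan) : ofCoord (coordMap p) = p := by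
  have h : Set.EqOn (ofCoord ∘ₗ coordMap) (LinearMap.id : Tensor4 →ₗ[ℂ] Tensor4) (cartan : Set Tensor4) := by
    refine LinearMap.eqOn_span ?_
    rintro y (rfl | rfl | rfl | rfl) <;>
    · simp only [LinearMap.comp_apply, LinearMap.id_apply, ofCoord_apply]
      simp [coordMap, e]
  exact h hp

/-- The linear coordinates on the Cartan subspace in which the roots are `±ε_k ± ε_l`. -/
def coord : cartan ≃ₗ[ℂ] (Fin 4 → ℂ) where
  toLinearMap := coordMap ∘ₗ cartan.subtype
  invFun f := ⟨ofCoord f, ofCoord_mem f⟩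
  left_inv p := Subtype.ext (ofCoord_coordMap p.2)
  right_inv f := coordMap_ofCoord f

theorem ofCoord_coord (p : cartan) : ofCoord (coord p) = p := ofCoord_coordMap p.2

theorem cartan_eq (p : cartan) : (p : Tensor4) =
    (1 / 2 : ℂ) • (bell * Matrix.diagonal (bellSign * coord p) * bell.transpose) := by
  conv_lhs => rw [← ofCoord_coord p]
  generalize coord p = f
  ext ⟨i, j⟩ ⟨k, l⟩
  fin_cases i <;> fin_cases j <;> fin_cases k <;> fin_cases l <;>
    simp [bell, bellSign, ofCoord_apply, e, Matrix.mul_apply, Fin.sum_univ_four,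
      finProdFinEquiv, Matrix.diagonal_apply] <;> ring

theorem cartan_transpose (p : cartan) : (p : Tensor4).transpose = p := by
  rw [cartan_eq]
  simp [Matrix.transpose_mul, Matrix.mul_assoc]

/-- The Bell vectors are common eigenvectors of `form4` and of all of 𝔥. The two factors `bellSign`
cancel, so the eigenvalues of this block of `toG p` are the coordinates themselves. -/
theorem cartan_mul_form4_mul_bell (p : cartan) :
    (p : Tensor4) * form4 * bell = bell * Matrix.diagonal (coord p) := by
  rw [Matrix.mul_assoc, form4_mul_bell, cartan_eq]
  simp only [Matrix.smul_mul, Matrix.mul_assoc]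
  rw [← Matrix.mul_assoc bell.transpose, bell_transpose_mul_bell]
  simp only [Matrix.smul_mul, Matrix.one_mul, Matrix.mul_smul, smul_smul,
    Matrix.diagonal_mul_diagonal]
  norm_num
  congr 2
  ext k
  linear_combination (coord p k) * bellSign_mul_self k

/-! ### Weight vectors -/

/-- The index set of the weights of `𝔥` on `ℂ⁸`. -/
abbrev Wt : Type := Fin 4 × ℤˣ

/-- The weight `s ε_k`. -/
def wt (i : Wt) : Module.Dual ℂ cartan :=
  ((i.2 : ℤ) : ℂ) • (LinearMap.proj i.1 ∘ₗ coord.toLinearMap)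

theorem wt_apply (i : Wt) (p : cartan) : wt i p = ((i.2 : ℤ) : ℂ) * coord p i.1 := rfl

/-- The matrix with the weight vectors as columns. -/
def wtMat : Matrix ((Fin 2 × Fin 2) ⊕ (Fin 2 × Fin 2)) Wt ℂ :=
  Matrix.of fun a i => Sum.elim (fun b => bell b i.1) (fun b => ((i.2 : ℤ) : ℂ) * bell b i.1) a

theorem intUnits_sq (s : ℤˣ) : ((s : ℤ) : ℂ) * ((s : ℤ) : ℂ) = 1 := by
  rcases Int.units_eq_one_or s with rfl | rfl <;> simp

/-- Since `p` is symmetric, both off-diagonal blocks of `toG p` equal `p * form4`; a Bell vector `b`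
with eigenvalue `c` therefore yields the eigenvectors `(b, ±b)` with eigenvalues `±c`. -/
theorem toG_mul_wtMat (p : cartan) :
    (toG (p : Tensor4)).1 * wtMat = wtMat * Matrix.diagonal (fun i => wt i p) := by
  have h := cartan_mul_form4_mul_bell p
  ext a ⟨k, s⟩
  have h1 : ∀ b, ∑ c, ((p : Tensor4) * form4) b c * bell c k = bell b k * coord p k := by
    intro b
    have := congrFun (congrFun h b) k
    rwa [Matrix.mul_apply, Matrix.mul_diagonal] at this
  rw [Matrix.mul_diagonal, Matrix.mul_apply, Fintype.sum_sum_type]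
  simp only [toG, LinearMap.coe_mk, AddHom.coe_mk, cartan_transpose, wtMat, Matrix.of_apply,
    Sum.elim_inl, Sum.elim_inr, wt_apply]
  rcases a with b | b
  · simp only [Matrix.fromBlocks_apply₁₁, Matrix.fromBlocks_apply₁₂, Matrix.zero_apply, zero_mul,
      Finset.sum_const_zero, zero_add, Sum.elim_inl]
    simp only [mul_left_comm _ ((s : ℤ) : ℂ), ← Finset.mul_sum, h1]
  · simp only [Matrix.fromBlocks_apply₂₁, Matrix.fromBlocks_apply₂₂, Matrix.zero_apply, zero_mul,
      Finset.sum_const_zero, add_zero, Sum.elim_inr, h1]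
    linear_combination - bell b k * coord p k * intUnits_sq s

/-- The cross terms cancel between the two signs. Consequently the weight vectors form a basis of
ℂ⁸, and matrices can be compared on them. -/
theorem wtMat_mul_transpose : wtMat * wtMat.transpose = (4 : ℂ) • 1 := by
  have h : ∀ b c, ∑ k, bell b k * bell c k = if b = c then 2 else 0 := by
    intro b c
    have := congrFun (congrFun bell_mul_bell_transpose b) c
    rw [Matrix.mul_apply, Matrix.smul_apply, Matrix.one_apply] at this
    simpa using this
  have hu : (Finset.univ : Finset ℤˣ) = {1, -1} := rfl
  ext a b
  rw [Matrix.mul_apply, Fintype.sum_prod_type]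
  rcases a with a | a <;> rcases b with b | b <;>
    simp [wtMat, hu, ← two_mul, ← Finset.mul_sum, h, Matrix.one_apply]
  · split_ifs <;> norm_num
  · split_ifs <;> norm_num

theorem eq_zero_of_wtMat {x : Matrix ((Fin 2 × Fin 2) ⊕ (Fin 2 × Fin 2))
    ((Fin 2 × Fin 2) ⊕ (Fin 2 × Fin 2)) ℂ} (h : wtMat.transpose * x * wtMat = 0) : x = 0 := by
  have h1 := congrArg (fun M => wtMat * M * wtMat.transpose) h
  simp only [Matrix.mul_zero, Matrix.zero_mul] at h1
  rw [Matrix.mul_assoc, Matrix.mul_assoc, wtMat_mul_transpose, ← Matrix.mul_assoc,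
    ← Matrix.mul_assoc, wtMat_mul_transpose] at h1
  simpa using h1

theorem eq_of_mul_wtMat {x y : Matrix ((Fin 2 × Fin 2) ⊕ (Fin 2 × Fin 2))
    ((Fin 2 × Fin 2) ⊕ (Fin 2 × Fin 2)) ℂ} (h : x * wtMat = y * wtMat) : x = y := by
  have h1 := congrArg (fun M => M * wtMat.transpose) h
  simp only [Matrix.mul_assoc, wtMat_mul_transpose] at h1
  simpa using h1

theorem form8_mul_form8 : form8 * form8 = 1 := by
  rw [form8, Matrix.fromBlocks_multiply]
  simp [form4_mul_form4]

theorem form8_transpose : form8.transpose = form8 := by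
  rw [form8, Matrix.fromBlocks_transpose]
  simp [form4_transpose]

theorem so8_transpose_mul (x : so8) : x.1.transpose * form8 = -(form8 * x.1) := by
  have h := x.2
  rw [mem_skewAdjointMatricesLieSubalgebra, mem_skewAdjointMatricesSubmodule,
    Matrix.IsSkewAdjoint, Matrix.IsAdjointPair] at h
  rw [h, Matrix.mul_neg]

/-! ### Roots -/

/-- This is so(8) ≅ Λ²(ℂ⁸): in the weight basis a root vector becomes an antisymmetric matrix `m`,
on which 𝔥 acts entry by entry with weights `-(wt i + wt j)`. Any nonzero entry determines the root.
-/
theorem exists_of_mem_roots {α : Module.Dual ℂ cartan} (hα : α ∈ roots) :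
    ∃ i j : Wt, i.1 ≠ j.1 ∧ α = wt i + wt j := by
  obtain ⟨h0, hne⟩ := hα
  obtain ⟨x, hx, hx0⟩ := (Submodule.ne_bot_iff _).mp hne
  set m := wtMat.transpose * (form8 * x.1) * wtMat with hm
  have hanti : m.transpose = -m := by
    rw [hm, Matrix.transpose_mul, Matrix.transpose_mul, Matrix.transpose_mul,
      Matrix.transpose_transpose, form8_transpose, so8_transpose_mul]
    simp [Matrix.mul_assoc]
  have hm0 : m ≠ 0 := by
    intro h
    have h1 := congrArg (fun M => form8 * M) (eq_zero_of_wtMat h)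
    simp only [← Matrix.mul_assoc, form8_mul_form8, Matrix.one_mul, Matrix.mul_zero] at h1
    exact hx0 (Subtype.ext h1)
  obtain ⟨i, j, hij⟩ : ∃ i j, m i j ≠ 0 := by
    by_contra! h
    exact hm0 (by ext i j; exact h i j)
  have key : ∀ p, α p = -(wt i p + wt j p) := by
    intro p
    have h1 := congrArg Subtype.val (hx p)
    rw [lie_val] at h1
    change _ = α p • x.1 at h1
    have h2 : wtMat.transpose * form8 * (toG (p : Tensor4)).1 =
        -(Matrix.diagonal (fun i => wt i p) * (wtMat.transpose * form8)) := by
      have h3 := congrArg Matrix.transpose (toG_mul_wtMat p)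
      rw [Matrix.transpose_mul, Matrix.transpose_mul, Matrix.diagonal_transpose] at h3
      rw [← Matrix.mul_assoc, ← h3, Matrix.mul_assoc, Matrix.mul_assoc, so8_transpose_mul]
      simp
    have h4 := congrArg (fun M => wtMat.transpose * form8 * M * wtMat) h1
    simp only [Matrix.mul_sub, Matrix.sub_mul] at h4
    rw [← Matrix.mul_assoc _ (toG (p : Tensor4)).1, h2, ← Matrix.mul_assoc _ x.1,
      Matrix.mul_assoc (_ * x.1), toG_mul_wtMat] at h4
    have h5 : -(Matrix.diagonal (fun i => wt i p) * m) -
        m * Matrix.diagonal (fun i => wt i p) = α p • m := by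
      rw [hm]
      simpa [Matrix.mul_assoc] using h4
    have h6 := congrFun (congrFun h5 i) j
    simp only [Matrix.sub_apply, Matrix.neg_apply, Matrix.diagonal_mul, Matrix.mul_diagonal,
      Matrix.smul_apply, smul_eq_mul] at h6
    refine mul_right_cancel₀ hij ?_
    linear_combination -h6
  -- Reversing both signs absorbs the minus in `key`. Equal indices are excluded: equal signs would
  -- give a diagonal entry of `m`, which is zero, and opposite signs would give the zero functional.
  refine ⟨(i.1, -i.2), (j.1, -j.2), ?_, ?_⟩
  · intro h
    have h : i.1 = j.1 := h
    rcases eq_or_ne i.2 j.2 with h' | h'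
    · have hij' : i = j := Prod.ext h h'
      have := congrFun (congrFun hanti i) j
      rw [hij', Matrix.transpose_apply, Matrix.neg_apply, eq_neg_iff_add_eq_zero,
        add_self_eq_zero] at this
      rw [hij'] at hij
      exact hij this
    · apply h0
      ext p
      have hs : j.2 = -i.2 := Int.units_ne_iff_eq_neg.mp h'.symm
      rw [key, wt_apply, wt_apply, hs, h]
      simp
  · ext p
    rw [key, LinearMap.add_apply]
    simp only [wt_apply]
    push_cast
    ring

/-- The trace form restricts to twice the standard dot product of coordinates, which identifies 𝔥
with its dual. -/
theorem trace_toG_mul_toG (p c : cartan) :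
    ((toG (p : Tensor4)).1 * (toG (c : Tensor4)).1).trace = 2 * ∑ k, coord p k * coord c k := by
  have hb : ∀ A : Matrix (Fin 2 × Fin 2) (Fin 2 × Fin 2) ℂ, ∀ d : Fin 4 → ℂ,
      A * bell = bell * Matrix.diagonal d → A.trace = ∑ k, d k := by
    intro A d h
    have h1 : A = (1 / 2 : ℂ) • (A * bell * bell.transpose) := by
      rw [Matrix.mul_assoc, bell_mul_bell_transpose]; simp
    rw [h1, h, Matrix.mul_assoc, Matrix.trace_smul, Matrix.trace_mul_comm, Matrix.mul_assoc,
      bell_transpose_mul_bell]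
    simp [Matrix.trace]
    rw [← Finset.mul_sum]
    ring
  have ht : ∀ A B C D : Matrix (Fin 2 × Fin 2) (Fin 2 × Fin 2) ℂ,
      (Matrix.fromBlocks A B C D).trace = A.trace + D.trace := by
    intro A B C D
    simp [Matrix.trace]
  simp only [toG, LinearMap.coe_mk, AddHom.coe_mk, cartan_transpose, Matrix.fromBlocks_multiply,
    ht]
  rw [Matrix.zero_mul, zero_add, add_zero, ← two_mul]
  rw [hb _ (fun k => coord p k * coord c k)]
  rw [Matrix.mul_assoc, cartan_mul_form4_mul_bell, ← Matrix.mul_assoc, cartan_mul_form4_mul_bell,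
    Matrix.mul_assoc, Matrix.diagonal_mul_diagonal]

/-- By invariance of the trace form, tr(p[x, y]) = tr([p, x]y) = α(p) tr(xy), so everything in [𝔤_α,
𝔤_{-α}] is proportional to α under this form. -/
theorem IsCoroot.exists_coord {α : Module.Dual ℂ cartan} {c : cartan} (h : IsCoroot α c) :
    ∃ κ : ℂ, ∀ p, ∑ k, coord p k * coord c k = κ * α p := by
  suffices H : ∀ z ∈ Submodule.span ℂ
      {z : so8 | ∃ x ∈ rootSpace α, ∃ y ∈ rootSpace (-α), z = ⁅x, y⁆},
      ∃ κ : ℂ, ∀ p : cartan, ((toG (p : Tensor4)).1 * z.1).trace = κ * α p by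
    obtain ⟨κ, hκ⟩ := H _ h.2
    refine ⟨κ / 2, fun p => ?_⟩
    have := hκ p
    rw [trace_toG_mul_toG] at this
    linear_combination this / 2
  intro z hz
  induction hz using Submodule.span_induction with
  | mem z hz =>
    obtain ⟨x, hx, y, hy, rfl⟩ := hz
    refine ⟨(x.1 * y.1).trace, fun p => ?_⟩
    have h1 := congrArg (fun z : so8 => (z.1 * y.1).trace) (hx p)
    change _ = ((α p • x.1) * y.1).trace at h1
    simp only [lie_val] at h1 ⊢
    rw [Matrix.smul_mul, Matrix.trace_smul, smul_eq_mul, Matrix.sub_mul, Matrix.trace_sub] at h1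
    rw [mul_comm, ← h1, Matrix.mul_sub, Matrix.trace_sub]
    congr 1
    · rw [Matrix.mul_assoc]
    · rw [← Matrix.mul_assoc, Matrix.trace_mul_comm, ← Matrix.mul_assoc]
  | zero => exact ⟨0, fun p => by simp⟩
  | add y z _ _ h1 h2 =>
    obtain ⟨a, ha⟩ := h1
    obtain ⟨b, hb⟩ := h2
    refine ⟨a + b, fun p => ?_⟩
    change ((toG (p : Tensor4)).1 * (y.1 + z.1)).trace = _
    rw [Matrix.mul_add, Matrix.trace_add, ha, hb, add_mul]
  | smul c y _ h1 =>
    obtain ⟨a, ha⟩ := h1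
    refine ⟨c * a, fun p => ?_⟩
    change ((toG (p : Tensor4)).1 * (c • y.1)).trace = _
    rw [Matrix.mul_smul, Matrix.trace_smul, ha, smul_eq_mul, mul_assoc]

/-- Uniqueness of the coroot: it is proportional to the root, and `α(c) = 2` fixes the factor, since
the vector has squared length 2. -/
theorem IsCoroot.coord_eq {i j : Wt} (hij : i.1 ≠ j.1) {c : cartan}
    (h : IsCoroot (wt i + wt j) c) :
    coord c = Pi.single i.1 ((i.2 : ℤ) : ℂ) + Pi.single j.1 ((j.2 : ℤ) : ℂ) := by
  obtain ⟨κ, hκ⟩ := h.exists_coord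
  have h1 : coord c =
      κ • (Pi.single i.1 ((i.2 : ℤ) : ℂ) + Pi.single j.1 ((j.2 : ℤ) : ℂ)) := by
    ext m
    have := hκ (coord.symm (Pi.single m 1))
    simp only [LinearEquiv.apply_symm_apply, LinearMap.add_apply, wt_apply] at this
    rw [Finset.sum_eq_single m (by intro b _ hb; rw [Pi.single_eq_of_ne hb, zero_mul])
      (by simp), Pi.single_eq_same, one_mul] at this
    rw [this]
    simp [Pi.single_apply, eq_comm]
  have h2 := h.1
  rw [LinearMap.add_apply, wt_apply, wt_apply, h1] at h2
  simp only [Pi.smul_apply, Pi.add_apply, Pi.single_eq_same, Pi.single_eq_of_ne hij,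
    Pi.single_eq_of_ne hij.symm, smul_eq_mul] at h2
  have hκ1 : κ = 1 := by
    linear_combination h2 / 2 - κ / 2 * intUnits_sq i.2 - κ / 2 * intUnits_sq j.2
  rw [h1, hκ1, one_smul]

/-! ### Existence of coroots -/

/-- The bilinear form on `ℂ⁸` given by `form8`. -/
def bil (v w : (Fin 2 × Fin 2) ⊕ (Fin 2 × Fin 2) → ℂ) : ℂ := v ⬝ᵥ form8.mulVec w

theorem bil_toG (x : so8) (v w : (Fin 2 × Fin 2) ⊕ (Fin 2 × Fin 2) → ℂ) :
    bil v (x.1.mulVec w) = -bil (x.1.mulVec v) w := by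
  have h := so8_transpose_mul x
  have h1 : form8 * x.1 = -(x.1.transpose * form8) := by rw [h, neg_neg]
  rw [bil, bil, Matrix.mulVec_mulVec, h1, Matrix.neg_mulVec, dotProduct_neg,
    ← Matrix.mulVec_mulVec, Matrix.dotProduct_mulVec, Matrix.vecMul_transpose]

/-- The skew endomorphism `u ↦ B(w, u) v - B(v, u) w`. -/
def wedge (v w : (Fin 2 × Fin 2) ⊕ (Fin 2 × Fin 2) → ℂ) : so8 :=
  ⟨(Matrix.vecMulVec v w - Matrix.vecMulVec w v) * form8, by
    rw [mem_skewAdjointMatricesLieSubalgebra, mem_skewAdjointMatricesSubmodule,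
      Matrix.IsSkewAdjoint, Matrix.IsAdjointPair, Matrix.transpose_mul, form8_transpose,
      Matrix.transpose_sub, Matrix.transpose_vecMulVec, Matrix.transpose_vecMulVec,
      Matrix.mul_assoc, ← Matrix.neg_mul, neg_sub]⟩

theorem wedge_mulVec (v w u : (Fin 2 × Fin 2) ⊕ (Fin 2 × Fin 2) → ℂ) :
    (wedge v w).1.mulVec u = bil w u • v - bil v u • w := by
  rw [wedge, ← Matrix.mulVec_mulVec, Matrix.sub_mulVec, Matrix.vecMulVec_mulVec,
    Matrix.vecMulVec_mulVec]
  simp [bil]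

/-- The weight vectors in `ℂ⁸`. -/
def wtVec (i : Wt) : (Fin 2 × Fin 2) ⊕ (Fin 2 × Fin 2) → ℂ := fun a => wtMat a i

theorem toG_mulVec_wtVec (p : cartan) (i : Wt) :
    (toG (p : Tensor4)).1.mulVec (wtVec i) = wt i p • wtVec i := by
  ext a
  have h := congrFun (congrFun (toG_mul_wtMat p) a) i
  rw [Matrix.mul_diagonal, Matrix.mul_apply] at h
  rw [Pi.smul_apply, smul_eq_mul, mul_comm]
  exact h

/-- Only opposite weights pair nontrivially. Each half of ℂ⁸ contributes `2 * bellSign`; the minus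
sign in `form8` makes the halves cancel for equal signs and add for opposite ones. -/
theorem bil_wtVec (i j : Wt) :
    bil (wtVec i) (wtVec j) = if j = (i.1, -i.2) then 4 * bellSign i.1 else 0 := by
  have h : ∀ k l, ∑ b, bell b k * ∑ c, form4 b c * bell c l =
      if k = l then 2 * bellSign k else 0 := by
    intro k l
    have h1 : bell.transpose * (form4 * bell) = (2 : ℂ) • Matrix.diagonal bellSign := by
      rw [form4_mul_bell, ← Matrix.mul_assoc, bell_transpose_mul_bell]
      simp
    have := congrFun (congrFun h1 k) l
    simp only [Matrix.mul_apply, Matrix.transpose_apply, Matrix.smul_apply,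
      Matrix.diagonal_apply] at this
    rw [this]
    split_ifs <;> simp
  obtain ⟨k, s⟩ := i
  obtain ⟨l, r⟩ := j
  have h2 : bil (wtVec (k, s)) (wtVec (l, r)) =
      (if k = l then 2 * bellSign k else 0) * (1 - ((s : ℤ) : ℂ) * ((r : ℤ) : ℂ)) := by
    rw [← h]
    simp only [bil, dotProduct, Matrix.mulVec, Fintype.sum_sum_type, form8, wtVec, wtMat,
      Matrix.of_apply, Sum.elim_inl, Sum.elim_inr, Matrix.fromBlocks_apply₁₁,
      Matrix.fromBlocks_apply₁₂, Matrix.fromBlocks_apply₂₁, Matrix.fromBlocks_apply₂₂,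
      Matrix.zero_apply, Matrix.neg_apply, zero_mul, Finset.sum_const_zero, add_zero, zero_add]
    simp only [neg_mul, Finset.sum_neg_distrib, mul_neg, mul_left_comm _ ((r : ℤ) : ℂ),
      ← Finset.mul_sum, mul_assoc]
    ring
  rw [h2]
  rcases Int.units_eq_one_or s with rfl | rfl <;> rcases Int.units_eq_one_or r with rfl | rfl <;>
    by_cases hkl : k = l <;> simp [hkl, Prod.ext_iff, eq_comm] <;> norm_num
  · ring
  · ring

/-- As `toG p` is skew for the form, it acts on v ∧ w as a derivation, and the weights of the two
factors add. -/
theorem wedge_mem_rootSpace (i j : Wt) :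
    wedge (wtVec i) (wtVec j) ∈ rootSpace (wt i + wt j) := by
  intro p
  apply Subtype.ext
  rw [lie_val]
  refine Matrix.ext_of_mulVec_single fun a => ?_
  change _ = Matrix.mulVec (((wt i + wt j) p) • (wedge (wtVec i) (wtVec j)).1) _
  generalize (Pi.single a (1 : ℂ) : (Fin 2 × Fin 2) ⊕ (Fin 2 × Fin 2) → ℂ) = u
  have hb : ∀ m : Wt, bil (wtVec m) ((toG (p : Tensor4)).1.mulVec u) =
      -(wt m p * bil (wtVec m) u) := by
    intro m
    rw [bil_toG, toG_mulVec_wtVec, bil, smul_dotProduct, bil, smul_eq_mul]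
  rw [Matrix.sub_mulVec, ← Matrix.mulVec_mulVec, ← Matrix.mulVec_mulVec, Matrix.smul_mulVec,
    wedge_mulVec, wedge_mulVec, Matrix.mulVec_sub, Matrix.mulVec_smul, Matrix.mulVec_smul,
    toG_mulVec_wtVec, toG_mulVec_wtVec, hb, hb, LinearMap.add_apply]
  module

/-- The vector `s ε_k + s' ε_l` in coordinates. -/
def corootVec (i j : Wt) : Fin 4 → ℂ :=
  Pi.single i.1 ((i.2 : ℤ) : ℂ) + Pi.single j.1 ((j.2 : ℤ) : ℂ)

theorem intUnits_ne_neg (s : ℤˣ) : s ≠ -s := by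
  rcases Int.units_eq_one_or s with rfl | rfl <;> decide

/-- The bracket is diagonal in the weight basis, with eigenvalues proportional to the values of the
weights at the coroot; 16 is the product of the two pairings from `bil_wtVec`. -/
theorem wedge_lie_wedge_mulVec {i j : Wt} (hij : i.1 ≠ j.1) (m : Wt) :
    ⁅wedge (wtVec i) (wtVec j), wedge (wtVec (i.1, -i.2)) (wtVec (j.1, -j.2))⁆.1.mulVec
      (wtVec m) = (-(16 * bellSign i.1 * bellSign j.1) *
        (((m.2 : ℤ) : ℂ) * corootVec i j m.1)) • wtVec m := by
  rw [lie_val, Matrix.sub_mulVec, ← Matrix.mulVec_mulVec, ← Matrix.mulVec_mulVec]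
  simp only [wedge_mulVec, Matrix.mulVec_sub, Matrix.mulVec_smul]
  obtain ⟨k, s⟩ := i
  obtain ⟨l, r⟩ := j
  obtain ⟨n, t⟩ := m
  have hs := intUnits_sq s
  have hr := intUnits_sq r
  simp only [bil_wtVec, neg_neg, Prod.mk.injEq, corootVec, Pi.add_apply, Pi.single_apply] at hij ⊢
  have hlk : l ≠ k := Ne.symm hij
  have ht : ∀ s : ℤˣ, t = s ∨ t = -s := fun s => by
    by_cases h : t = s
    · exact Or.inl h
    · exact Or.inr (Int.units_ne_iff_eq_neg.mp h)
  by_cases hnk : n = k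
  · subst hnk
    rcases ht s with rfl | rfl <;>
      simp [hij, hlk, (intUnits_ne_neg _).symm, hs, smul_smul] <;>
      module
  · by_cases hnl : n = l
    · subst hnl
      rcases ht r with rfl | rfl <;>
        simp [hij, hlk, (intUnits_ne_neg _).symm, hr, smul_smul] <;>
        module
    · simp [hnk, hnl]

/-- The expected vector is a multiple of the bracket of two opposite wedges, because both sides
agree on every weight vector. -/
theorem isCoroot {i j : Wt} (hij : i.1 ≠ j.1) :
    IsCoroot (wt i + wt j) (coord.symm (corootVec i j)) := by
  constructor
  · rw [LinearMap.add_apply, wt_apply, wt_apply, LinearEquiv.apply_symm_apply, corootVec]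
    simp only [Pi.add_apply, Pi.single_eq_same, Pi.single_eq_of_ne hij,
      Pi.single_eq_of_ne hij.symm]
    linear_combination intUnits_sq i.2 + intUnits_sq j.2
  · have hneg : -(wt i + wt j) = wt (i.1, -i.2) + wt (j.1, -j.2) := by
      ext p
      rw [LinearMap.neg_apply, LinearMap.add_apply, LinearMap.add_apply]
      simp only [wt_apply]
      push_cast
      ring
    have hmem : ⁅wedge (wtVec i) (wtVec j), wedge (wtVec (i.1, -i.2)) (wtVec (j.1, -j.2))⁆ ∈
        Submodule.span ℂ {z : so8 | ∃ x ∈ rootSpace (wt i + wt j),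
          ∃ y ∈ rootSpace (-(wt i + wt j)), z = ⁅x, y⁆} := by
      refine Submodule.subset_span ⟨_, wedge_mem_rootSpace i j, _, ?_, rfl⟩
      rw [hneg]
      exact wedge_mem_rootSpace _ _
    have h : toG (coord.symm (corootVec i j) : Tensor4) =
        (-(bellSign i.1 * bellSign j.1) / 16) •
          ⁅wedge (wtVec i) (wtVec j), wedge (wtVec (i.1, -i.2)) (wtVec (j.1, -j.2))⁆ := by
      apply Subtype.ext
      apply eq_of_mul_wtMat
      ext a m
      have h1 := congrFun (toG_mulVec_wtVec (coord.symm (corootVec i j)) m) a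
      have h2 := congrFun (wedge_lie_wedge_mulVec hij m) a
      rw [wt_apply, LinearEquiv.apply_symm_apply] at h1
      change ((toG (coord.symm (corootVec i j) : Tensor4)).1.mulVec (wtVec m)) a =
        (((-(bellSign i.1 * bellSign j.1) / 16) •
          ⁅wedge (wtVec i) (wtVec j), wedge (wtVec (i.1, -i.2)) (wtVec (j.1, -j.2))⁆.1).mulVec
            (wtVec m)) a
      rw [Matrix.smul_mulVec, Pi.smul_apply, h2, h1]
      simp only [Pi.smul_apply, smul_eq_mul]
      linear_combination (-((m.2 : ℤ) : ℂ) * corootVec i j m.1 * wtVec m a *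
        (bellSign j.1 * bellSign j.1)) * bellSign_mul_self i.1 -
        ((m.2 : ℤ) : ℂ) * corootVec i j m.1 * wtVec m a * bellSign_mul_self j.1
    rw [h]
    exact Submodule.smul_mem _ _ hmem

theorem wt_add_wt_mem_roots {i j : Wt} (hij : i.1 ≠ j.1) : wt i + wt j ∈ roots := by
  refine ⟨?_, (isCoroot hij).rootSpace_ne_bot⟩
  intro h
  have := (isCoroot hij).1
  rw [h, LinearMap.zero_apply] at this
  norm_num at this

theorem roots_finite : roots.Finite := by
  refine (Set.finite_range fun ij : Wt × Wt => wt ij.1 + wt ij.2).subset ?_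
  intro α hα
  obtain ⟨i, j, -, rfl⟩ := exists_of_mem_roots hα
  exact ⟨(i, j), rfl⟩

/-! ### The Weyl group as a group of signed permutations -/

/-- The signed permutation of the coordinates that maps the `i`-th one to the `π i`-th one. -/
def signedPerm (π : Equiv.Perm (Fin 4)) (s : Fin 4 → ℤˣ) : cartan ≃ₗ[ℂ] cartan :=
  coord.trans <| LinearEquiv.trans
    { toFun := fun f i => ((s (π.symm i) : ℤ) : ℂ) * f (π.symm i)
      invFun := fun f i => ((s i : ℤ) : ℂ) * f (π i)
      map_add' := fun f g => by ext i; simp [mul_add]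
      map_smul' := fun c f => by ext i; simp [mul_left_comm]
      left_inv := fun f => by ext i; simp [← mul_assoc, intUnits_sq]
      right_inv := fun f => by ext i; simp [← mul_assoc, intUnits_sq] } coord.symm

theorem coord_signedPerm (π : Equiv.Perm (Fin 4)) (s : Fin 4 → ℤˣ) (p : cartan) (i : Fin 4) :
    coord (signedPerm π s p) (π i) = ((s i : ℤ) : ℂ) * coord p i := by
  simp [signedPerm]

theorem eq_signedPerm {w : cartan ≃ₗ[ℂ] cartan} {π : Equiv.Perm (Fin 4)} {s : Fin 4 → ℤˣ}
    (h : ∀ p i, coord (w p) (π i) = ((s i : ℤ) : ℂ) * coord p i) : w = signedPerm π s := by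
  ext1 p
  apply coord.injective
  ext i
  obtain ⟨i, rfl⟩ := π.surjective i
  rw [h, coord_signedPerm]

theorem signedPerm_mul (π ρ : Equiv.Perm (Fin 4)) (s r : Fin 4 → ℤˣ) :
    signedPerm π s * signedPerm ρ r = signedPerm (π * ρ) (fun i => s (ρ i) * r i) := by
  apply eq_signedPerm
  intro p i
  rw [LinearEquiv.mul_apply, Equiv.Perm.mul_apply, coord_signedPerm, coord_signedPerm]
  push_cast
  ring

theorem signedPerm_one : signedPerm 1 1 = 1 := (eq_signedPerm fun p i => by simp).symm

/-- The group of even signed permutations. -/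
def evenSigned : Subgroup (cartan ≃ₗ[ℂ] cartan) where
  carrier := {w | ∃ π s, ∏ i, s i = 1 ∧ w = signedPerm π s}
  one_mem' := ⟨1, 1, by simp, signedPerm_one.symm⟩
  mul_mem' := by
    rintro _ _ ⟨π, s, hs, rfl⟩ ⟨ρ, r, hr, rfl⟩
    refine ⟨_, _, ?_, signedPerm_mul π ρ s r⟩
    rw [Finset.prod_mul_distrib, hr, mul_one, Equiv.prod_comp, hs]
  inv_mem' := by
    rintro _ ⟨π, s, hs, rfl⟩
    refine ⟨π⁻¹, fun i => s (π⁻¹ i), ?_, ?_⟩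
    · rw [Equiv.prod_comp, hs]
    · rw [inv_eq_iff_mul_eq_one, signedPerm_mul, ← signedPerm_one]
      congr 1
      · simp
      · ext i
        simp

theorem evenSigned_finite : (evenSigned : Set (cartan ≃ₗ[ℂ] cartan)).Finite := by
  refine (Set.finite_range fun a : Equiv.Perm (Fin 4) × (Fin 4 → ℤˣ) =>
    signedPerm a.1 a.2).subset ?_
  rintro _ ⟨π, s, -, rfl⟩
  exact ⟨(π, s), rfl⟩

/-- The signs of the reflection exchanging the coordinates `k` and `l` up to the sign `u`. -/
def pairSign (k l : Fin 4) (u : ℤˣ) : Fin 4 → ℤˣ := fun i => if i = k ∨ i = l then u else 1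

theorem prod_pairSign {k l : Fin 4} (h : k ≠ l) (u : ℤˣ) : ∏ i, pairSign k l u i = 1 := by
  revert k l u
  decide

/-- The reflection in the root `ε_k - u ε_l`. -/
def swapRefl (k l : Fin 4) (u : ℤˣ) : cartan ≃ₗ[ℂ] cartan :=
  signedPerm (Equiv.swap k l) (pairSign k l u)

/-- Up to sign the root s ε_k + r ε_l is ε_k - u ε_l with u = -s r. As the coroot is unique, every
generator of W has this form. -/
theorem eq_swapRefl {i j : Wt} (hij : i.1 ≠ j.1) {c : cartan} (hc : IsCoroot (wt i + wt j) c)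
    {w : cartan ≃ₗ[ℂ] cartan} (hw : ∀ p, w p = p - (wt i + wt j) p • c) :
    w = swapRefl i.1 j.1 (-(i.2 * j.2)) := by
  apply eq_signedPerm
  intro p m
  have hs := intUnits_sq i.2
  have hr := intUnits_sq j.2
  rw [hw, map_sub, map_smul, hc.coord_eq hij]
  simp only [LinearMap.add_apply, wt_apply, Pi.sub_apply, Pi.smul_apply, Pi.add_apply,
    smul_eq_mul, pairSign]
  by_cases h1 : m = i.1
  · subst h1
    rw [Equiv.swap_apply_left]
    simp [hij, hij.symm]
    linear_combination -coord p j.1 * hr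
  · by_cases h2 : m = j.1
    · subst h2
      rw [Equiv.swap_apply_right]
      simp [hij, hij.symm]
      linear_combination -coord p i.1 * hs
    · rw [Equiv.swap_apply_of_ne_of_ne h1 h2]
      simp [h1, h2]

theorem swapRefl_eq {i j : Wt} (hij : i.1 ≠ j.1) (p : cartan) :
    swapRefl i.1 j.1 (-(i.2 * j.2)) p = p - (wt i + wt j) p • coord.symm (corootVec i j) := by
  have h := isCoroot hij
  -- The reflection formula defines an involution because the root takes the value 2 on its coroot;
  -- as a linear equivalence it can be identified by `eq_swapRefl`.
  have := eq_swapRefl hij h (w := LinearEquiv.ofInvolutive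
    (LinearMap.id - (wt i + wt j).smulRight (coord.symm (corootVec i j))) (by
      intro p
      simp only [LinearMap.sub_apply, LinearMap.id_apply, LinearMap.smulRight_apply, map_sub,
        map_smul, h.1]
      module)) (fun p => rfl)
  rw [← this]
  rfl

theorem weyl_le_evenSigned : weyl ≤ evenSigned := by
  rw [weyl, weylSub, Subgroup.closure_le]
  rintro w ⟨α, hα, c, hc, hw⟩
  obtain ⟨i, j, hij, rfl⟩ := exists_of_mem_roots hα
  exact ⟨_, _, prod_pairSign hij _, eq_swapRefl hij hc hw⟩

theorem weylSub_mono {P Q : Set (Module.Dual ℂ cartan)} (h : P ⊆ Q) : weylSub P ≤ weylSub Q := by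
  refine Subgroup.closure_mono ?_
  rintro w ⟨α, hα, hw⟩
  exact ⟨α, h hα, hw⟩

theorem swapRefl_mem_weylSub {P : Set (Module.Dual ℂ cartan)} {k l : Fin 4} (hkl : k ≠ l)
    {u : ℤˣ} {x : cartan} (hP : ∀ α ∈ roots, α x = 0 → α ∈ P)
    (hx : coord x k = ((u : ℤ) : ℂ) * coord x l) : swapRefl k l u ∈ weylSub P := by
  have h := swapRefl_eq (i := (k, 1)) (j := (l, -u)) hkl
  have h0 : wt (k, 1) + wt (l, -u) ∈ roots := wt_add_wt_mem_roots hkl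
  refine Subgroup.subset_closure ⟨_, hP _ h0 ?_, _, isCoroot (i := (k, 1)) (j := (l, -u)) hkl, ?_⟩
  · rw [LinearMap.add_apply, wt_apply, wt_apply]
    simp [hx]
  · intro p
    rw [← h p]
    simp

/-- An even sign change negates 0, 2 or 4 coordinates. Negating a pair `k, l` is the product of the
reflections in ε_k - ε_l and ε_k + ε_l, both of which vanish at `x` when these coordinates do. -/
theorem signedPerm_one_mem {P : Set (Module.Dual ℂ cartan)} {s : Fin 4 → ℤˣ} {x : cartan}
    (hP : ∀ α ∈ roots, α x = 0 → α ∈ P) (hs : ∏ i, s i = 1)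
    (hx : ∀ i, s i = -1 → coord x i = 0) : signedPerm 1 s ∈ weylSub P := by
  have hpair : ∀ k l, k ≠ l → coord x k = 0 → coord x l = 0 →
      signedPerm 1 (pairSign k l (-1)) ∈ weylSub P := by
    intro k l hkl hk hl
    have h1 := swapRefl_mem_weylSub (u := 1) hkl hP (by rw [hk, hl]; simp)
    have h2 := swapRefl_mem_weylSub (u := -1) hkl hP (by rw [hk, hl]; simp)
    have h3 := (weylSub P).mul_mem h1 h2
    rw [swapRefl, swapRefl, signedPerm_mul, Equiv.swap_mul_self] at h3
    convert h3 using 3 with i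
    simp [pairSign]
  have hcases : ∀ s : Fin 4 → ℤˣ, ∏ i, s i = 1 → s = 1 ∨
      (∃ k l, k ≠ l ∧ s k = -1 ∧ s l = -1 ∧ s = pairSign k l (-1)) ∨
      (s = fun i => pairSign 0 1 (-1) i * pairSign 2 3 (-1) i) := by decide
  rcases hcases s hs with rfl | ⟨k, l, hkl, hk, hl, rfl⟩ | rfl
  · rw [signedPerm_one]; exact one_mem _
  · exact hpair k l hkl (hx k hk) (hx l hl)
  · have h := (weylSub P).mul_mem
      (hpair 0 1 (by decide) (hx _ (by decide)) (hx _ (by decide)))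
      (hpair 2 3 (by decide) (hx _ (by decide)) (hx _ (by decide)))
    rwa [signedPerm_mul] at h

/-- Stabilisers in the Weyl group are generated by reflections. -/
theorem mem_weylSub_of_fixes {P : Set (Module.Dual ℂ cartan)} {x : cartan}
    (hP : ∀ α ∈ roots, α x = 0 → α ∈ P) {w : cartan ≃ₗ[ℂ] cartan} (hw : w ∈ evenSigned)
    (hwx : w x = x) : w ∈ weylSub P := by
  obtain ⟨π, s, hs, rfl⟩ := hw
  induction hn : π.support.card using Nat.strong_induction_on generalizing π s with
  | _ n ih =>
    by_cases hπ : π = 1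
    · subst hπ
      refine signedPerm_one_mem hP hs fun i hi => ?_
      have h := coord_signedPerm 1 s x i
      rw [hwx, hi] at h
      have h : coord x i = _ := h
      rw [← add_self_eq_zero]
      nth_rewrite 1 [h]
      simp
    · obtain ⟨i, hi⟩ : ∃ i, π i ≠ i := by
        by_contra! h
        exact hπ (Equiv.ext h)
      -- Since the signed permutation fixes `x`, the root ε_i - s_i ε_{π i} vanishes at `x`.
      -- Multiplying by its reflection makes the underlying permutation fix `i` and shrinks its
      -- support.
      have hr : swapRefl i (π i) (s i) ∈ weylSub P := by
        refine swapRefl_mem_weylSub (Ne.symm hi) hP ?_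
        have h := coord_signedPerm π s x i
        rw [hwx] at h
        rw [h, ← mul_assoc, intUnits_sq, one_mul]
      have hfix : swapRefl i (π i) (s i) x = x := by
        -- `P` may contain functionals that do not vanish at `x`, so the fixed point is obtained
        -- with the set of functionals vanishing there.
        refine weylSub_fixes (P := {α | α x = 0}) ?_ (x := x) (fun α hα => hα)
        refine swapRefl_mem_weylSub (Ne.symm hi) (fun α _ h => h) ?_
        have h := coord_signedPerm π s x i
        rw [hwx] at h
        rw [h, ← mul_assoc, intUnits_sq, one_mul]
      have hmul : swapRefl i (π i) (s i) * signedPerm π s = _ := signedPerm_mul _ _ _ _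
      have h := ih _ (hn ▸ Equiv.Perm.card_support_swap_mul hi) (Equiv.swap i (π i) * π)
        (fun j => pairSign i (π i) (s i) (π j) * s j) ?_ ?_ rfl
      · rw [← hmul] at h
        exact (Subgroup.mul_mem_cancel_left _ hr).mp h
      · rw [Finset.prod_mul_distrib, hs, mul_one, Equiv.prod_comp π, prod_pairSign (Ne.symm hi)]
      · rw [← hmul, LinearEquiv.mul_apply, hwx, hfix]

theorem evenSigned_eq_weyl : evenSigned = weyl := by
  refine le_antisymm (fun w hw => ?_) weyl_le_evenSigned
  -- Every linear map fixes 0, where all roots vanish, so the stabiliser statement covers the whole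
  -- group.
  exact mem_weylSub_of_fixes (x := 0) (fun α hα _ => hα) hw (map_zero w)

/-! ### Realising the Weyl group in `SL(2,ℂ)⁴` -/

/-- The linear automorphisms of the Cartan subspace that are restrictions of elements of
`SL(2,ℂ)⁴`. -/
def realised : Subgroup (cartan ≃ₗ[ℂ] cartan) where
  carrier := {w | ∃ g : GHat, ∀ p : cartan, (w p : Tensor4) = g • (p : Tensor4)}
  one_mem' := ⟨1, fun p => by simp⟩
  mul_mem' := by
    rintro v w ⟨g, hg⟩ ⟨h, hh⟩
    exact ⟨g * h, fun p => by rw [LinearEquiv.mul_apply, hg, hh, mul_smul]⟩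
  inv_mem' := by
    rintro w ⟨g, hg⟩
    refine ⟨g⁻¹, fun p => ?_⟩
    rw [eq_inv_smul_iff, ← hg]
    exact congrArg Subtype.val (w.apply_symm_apply p)

theorem coord_swapRefl (k l : Fin 4) (u : ℤˣ) (p : cartan) (i : Fin 4) :
    coord (swapRefl k l u p) i = ((pairSign k l u i : ℤ) : ℂ) * coord p (Equiv.swap k l i) := by
  have h := coord_signedPerm (Equiv.swap k l) (pairSign k l u) p (Equiv.swap k l i)
  rw [Equiv.swap_apply_self] at h
  have hsym : ∀ (k l : Fin 4) (u : ℤˣ) (i : Fin 4),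
      pairSign k l u (Equiv.swap k l i) = pairSign k l u i := by decide
  rw [swapRefl, h, hsym]

theorem swapRefl_mem_realised {k l : Fin 4} {u : ℤˣ} (g : GHat)
    (h : ∀ f : Fin 4 → ℂ, ofCoord (fun i => ((pairSign k l u i : ℤ) : ℂ) * f (Equiv.swap k l i)) =
      g • ofCoord f) : swapRefl k l u ∈ realised := by
  refine ⟨g, fun p => ?_⟩
  rw [← ofCoord_coord (swapRefl k l u p), ← ofCoord_coord p, ← h]
  congr 1
  ext i
  exact coord_swapRefl k l u p i

theorem swapRefl_comm (k l : Fin 4) (u : ℤˣ) : swapRefl k l u = swapRefl l k u := by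
  rw [swapRefl, swapRefl, Equiv.swap_comm]
  congr 1
  ext i
  simp [pairSign, or_comm]

/-- Conjugating by a reflection moves an index, which produces all reflections from the few realised
by explicit matrices. -/
theorem swapRefl_conj {k l m : Fin 4} (hkl : k ≠ l) (hlm : l ≠ m) (hkm : k ≠ m) (u v : ℤˣ) :
    swapRefl l m v * swapRefl k l u * swapRefl l m v = swapRefl k m (u * v) := by
  simp only [swapRefl, signedPerm_mul]
  congr 1
  · revert k l m
    decide
  · funext i
    revert k l m u v i
    decide

/-- The diagonal matrix with entries `z` and `-z³ = z⁻¹`, for a primitive eighth root of unity `z`. -/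
def diagSL (z : ℂ) (hz : z ^ 4 = -1) : Matrix.SpecialLinearGroup (Fin 2) ℂ :=
  ⟨!![z, 0; 0, -z ^ 3], by rw [Matrix.det_fin_two_of]; linear_combination -hz⟩

theorem smul_apply_of_diag {g : GHat} (hg : ∀ m i j, i ≠ j → (g m).1 i j = 0) (x : Tensor4)
    (i₁ i₂ i₃ i₄ : Fin 2) : (g • x) (i₁, i₂) (i₃, i₄) =
      (g 0).1 i₁ i₁ * (g 1).1 i₂ i₂ * (g 2).1 i₃ i₃ * (g 3).1 i₄ i₄ * x (i₁, i₂) (i₃, i₄) := by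
  rw [smul_apply, Finset.sum_eq_single i₁, Finset.sum_eq_single i₂, Finset.sum_eq_single i₃,
    Finset.sum_eq_single i₄]
  all_goals
    first
      | exact fun h => absurd (Finset.mem_univ _) h
      | exact fun j _ hj => by simp [hg _ _ j (Ne.symm hj)]

theorem exists_flips : swapRefl 0 1 1 ∈ realised ∧ swapRefl 0 1 (-1) ∈ realised ∧
    swapRefl 2 3 1 ∈ realised ∧ swapRefl 2 3 (-1) ∈ realised := by
  obtain ⟨z, hz⟩ := IsAlgClosed.exists_pow_nat_eq (-1 : ℂ) (n := 4) (by norm_num)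
  have hz' : (-z ^ 3) ^ 4 = -1 := by linear_combination (z ^ 8 - z ^ 4 + 1) * hz
  set A := diagSL z hz with hA
  set B := diagSL (-z ^ 3) hz' with hB
  -- Here `B` is the inverse of `A`. Each choice multiplies one of u₁, u₄, u₃, u₂, in this order, by
  -- z⁴ = -1 and fixes the other three.
  refine ⟨swapRefl_mem_realised ![A, A, A, A] ?_, swapRefl_mem_realised ![A, A, B, B] ?_,
    swapRefl_mem_realised ![A, B, A, B] ?_, swapRefl_mem_realised ![A, B, B, A] ?_⟩ <;>
  · intro f
    ext ⟨i, j⟩ ⟨k, l⟩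
    rw [smul_apply_of_diag (by
      intro m i j hij
      fin_cases m <;> fin_cases i <;> fin_cases j <;> simp [hA, hB, diagSL] at hij ⊢)]
    fin_cases i <;> fin_cases j <;> fin_cases k <;> fin_cases l <;>
      simp [hA, hB, diagSL, ofCoord_apply, e, pairSign, Equiv.swap_apply_def] <;> grind

/-- A Hadamard matrix, scaled to determinant 1 and used in all four factors, links the index pairs
{0, 1} and {2, 3} that the diagonal matrices keep apart. -/
theorem exists_hadamard : swapRefl 1 2 1 ∈ realised := by
  obtain ⟨r, hr⟩ := IsAlgClosed.exists_pow_nat_eq (-1 / 2 : ℂ) (n := 2) (by norm_num)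
  let H : Matrix.SpecialLinearGroup (Fin 2) ℂ :=
    ⟨!![r, r; r, -r], by rw [Matrix.det_fin_two_of]; linear_combination -2 * hr⟩
  refine swapRefl_mem_realised (fun _ => H) ?_
  intro f
  ext ⟨i, j⟩ ⟨k, l⟩
  rw [smul_apply]
  fin_cases i <;> fin_cases j <;> fin_cases k <;> fin_cases l <;>
    simp [H, ofCoord_apply, e, pairSign, Equiv.swap_apply_def] <;> grind

theorem swapRefl_mem_realised_of_ne {k l : Fin 4} (hkl : k ≠ l) (u : ℤˣ) :
    swapRefl k l u ∈ realised := by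
  obtain ⟨h1, h2, h3, h4⟩ := exists_flips
  have conj : ∀ {k l m : Fin 4} (u v : ℤˣ), k ≠ l → l ≠ m → k ≠ m →
      swapRefl k l u ∈ realised → swapRefl l m v ∈ realised →
        swapRefl k m (u * v) ∈ realised := fun u v hkl hlm hkm h h' => by
    rw [← swapRefl_conj hkl hlm hkm]
    exact mul_mem (mul_mem h' h) h'
  have all : ∀ {k l : Fin 4}, swapRefl k l 1 ∈ realised → swapRefl k l (-1) ∈ realised →
      ∀ u, swapRefl k l u ∈ realised := fun h h' u => by
    rcases Int.units_eq_one_or u with rfl | rfl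
    · exact h
    · exact h'
  have h01 := all h1 h2
  have h23 := all h3 h4
  have h02 : ∀ u, swapRefl 0 2 u ∈ realised := fun u => by
    simpa using conj u 1 (by decide) (by decide) (by decide) (h01 u) exists_hadamard
  have h12 : ∀ u, swapRefl 1 2 u ∈ realised := fun u => by
    have := conj (k := 1) (l := 0) (m := 2) u 1 (by decide) (by decide) (by decide)
      (swapRefl_comm 0 1 u ▸ h01 u) (h02 1)
    simpa using this
  have h03 : ∀ u, swapRefl 0 3 u ∈ realised := fun u => by
    simpa using conj u 1 (by decide) (by decide) (by decide) (h02 u) (h23 1)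
  have h13 : ∀ u, swapRefl 1 3 u ∈ realised := fun u => by
    simpa using conj u 1 (by decide) (by decide) (by decide) (h12 u) (h23 1)
  have hlt : ∀ k l : Fin 4, k < l → ∀ u, swapRefl k l u ∈ realised := by
    intro k l h
    fin_cases k <;> fin_cases l <;> first | exact absurd h (by decide) | assumption
  rcases lt_or_gt_of_ne hkl with h | h
  · exact hlt k l h u
  · rw [swapRefl_comm]
    exact hlt l k h u

theorem weyl_le_realised : weyl ≤ realised := by
  rw [weyl, weylSub, Subgroup.closure_le]
  rintro w ⟨α, hα, c, hc, hw⟩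
  obtain ⟨i, j, hij, rfl⟩ := exists_of_mem_roots hα
  rw [eq_swapRefl hij hc hw]
  exact swapRefl_mem_realised_of_ne hij _

/-! ### Elements of the Cartan subspace in the same orbit -/

/-- Equal multisets of roots mean that the fibres of `a` and `b` over each value have equal size,
and fibrewise bijections glue to a permutation. -/
theorem exists_perm_of_prod_X_sub_C_eq {a b : Fin 4 → ℂ}
    (h : ∏ i, (Polynomial.X - Polynomial.C (a i)) = ∏ i, (Polynomial.X - Polynomial.C (b i))) :
    ∃ π : Equiv.Perm (Fin 4), ∀ i, b (π i) = a i := by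
  have hroots : ∀ a : Fin 4 → ℂ, (∏ i, (Polynomial.X - Polynomial.C (a i))).roots =
      Finset.univ.val.map a := by
    intro a
    exact Polynomial.roots_multiset_prod_X_sub_C (Finset.univ.val.map a) ▸ by
      rw [Multiset.map_map]; rfl
  have hm : Finset.univ.val.map a = Finset.univ.val.map b := by rw [← hroots, h, hroots]
  have hc : ∀ c, Fintype.card {i // a i = c} = Fintype.card {i // b i = c} := by
    intro c
    have := congrArg (Multiset.count c) hm
    rw [Multiset.count_map, Multiset.count_map] at this
    rw [Fintype.card_subtype, Fintype.card_subtype]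
    simpa only [eq_comm, Finset.card_def, Finset.filter_val] using this
  exact ⟨Equiv.ofFiberEquiv fun c => Fintype.equivOfCardEq (hc c), fun i =>
    Equiv.ofFiberEquiv_map _ i⟩

theorem eq_of_mul_bell {A : Matrix (Fin 2 × Fin 2) (Fin 2 × Fin 2) ℂ} {d : Fin 4 → ℂ}
    (h : A * bell = bell * Matrix.diagonal d) :
    A = bell * (Matrix.diagonal d * ((1 / 2 : ℂ) • bell.transpose)) := by
  rw [← Matrix.mul_assoc, ← h, Matrix.mul_assoc, Matrix.mul_smul, bell_mul_bell_transpose]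
  simp

theorem charpoly_of_mul_bell {A : Matrix (Fin 2 × Fin 2) (Fin 2 × Fin 2) ℂ} {d : Fin 4 → ℂ}
    (h : A * bell = bell * Matrix.diagonal d) :
    A.charpoly = ∏ i, (Polynomial.X - Polynomial.C (d i)) := by
  rw [eq_of_mul_bell h, Matrix.charpoly_mul_comm_of_le _ _ (by simp), Matrix.mul_assoc,
    Matrix.smul_mul, bell_transpose_mul_bell]
  simp [Matrix.charpoly_diagonal]

theorem det_of_mul_bell {A : Matrix (Fin 2 × Fin 2) (Fin 2 × Fin 2) ℂ} {d : Fin 4 → ℂ}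
    (h : A * bell = bell * Matrix.diagonal d) : A.det = ∏ i, d i := by
  rw [eq_of_mul_bell h, ← Matrix.mul_assoc, Matrix.det_conj_of_mul_eq_one, Matrix.det_diagonal]
  · rw [Matrix.mul_smul, bell_mul_bell_transpose]; simp
  · rw [Matrix.smul_mul, bell_transpose_mul_bell]; simp

/-- This invariant detects the parity of the sign changes, which the squares of the coordinates
cannot see. -/
theorem det_cartan (p : cartan) : (p : Tensor4).det = ∏ i, coord p i := by
  have h := det_of_mul_bell (cartan_mul_form4_mul_bell p)
  rwa [Matrix.det_mul, det_of_mul_bell form4_mul_bell,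
    show ∏ i, bellSign i = 1 by simp [bellSign, Fin.prod_univ_four], mul_one] at h

theorem det_kronecker_special (A B : Matrix.SpecialLinearGroup (Fin 2) ℂ) :
    (A.1 ⊗ₖ B.1).det = 1 := by
  rw [Matrix.det_kronecker, A.2, B.2]
  simp

theorem det_smul_tensor (g : GHat) (x : Tensor4) : (g • x).det = x.det := by
  rw [smul_def, Matrix.det_mul, Matrix.det_mul, Matrix.det_transpose, det_kronecker_special,
    det_kronecker_special, one_mul, mul_one]

/-- The matrix is the upper left block of the square of `toG x`, on which `g` acts by conjugation
with A ⊗ B. -/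
theorem charpoly_smul_tensor (g : GHat) (x : Tensor4) :
    ((g • x) * form4 * ((g • x).transpose * form4)).charpoly =
      (x * form4 * (x.transpose * form4)).charpoly := by
  have h := toG_smul g x
  set M := Matrix.fromBlocks ((g 0).1 ⊗ₖ (g 1).1) 0 0 ((g 2).1 ⊗ₖ (g 3).1) with hM
  have h2 : (toG (g • x)).1 * (toG (g • x)).1 * M = M * ((toG x).1 * (toG x).1) := by
    rw [Matrix.mul_assoc, h, ← Matrix.mul_assoc, h, Matrix.mul_assoc]
  have h3 := congrArg Matrix.toBlocks₁₁ h2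
  simp only [toG, LinearMap.coe_mk, AddHom.coe_mk, hM, Matrix.fromBlocks_multiply,
    Matrix.toBlocks_fromBlocks₁₁, Matrix.mul_zero, Matrix.zero_mul, zero_add, add_zero] at h3
  have hu : IsUnit ((g 0).1 ⊗ₖ (g 1).1) := by
    rw [Matrix.isUnit_iff_isUnit_det, det_kronecker_special]
    exact isUnit_one
  obtain ⟨u, hu⟩ := hu
  rw [← hu] at h3
  rw [← Matrix.charpoly_units_conj u (x * form4 * (x.transpose * form4)), ← h3, Matrix.mul_assoc]
  simp

/-- Points of the Cartan subspace in the same `SL(2,ℂ)⁴`-orbit are conjugate under the Weyl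
group. -/
theorem exists_mem_weyl_of_smul_eq {g : GHat} {x y : cartan} (h : g • (x : Tensor4) = y) :
    ∃ w ∈ weyl, w x = y := by
  have hsq : ∀ p : cartan, ((p : Tensor4) * form4 * ((p : Tensor4).transpose * form4)).charpoly =
      ∏ i, (Polynomial.X - Polynomial.C (coord p i * coord p i)) := by
    intro p
    apply charpoly_of_mul_bell
    rw [cartan_transpose, Matrix.mul_assoc, cartan_mul_form4_mul_bell, ← Matrix.mul_assoc,
      cartan_mul_form4_mul_bell, Matrix.mul_assoc, Matrix.diagonal_mul_diagonal]
  have h1 := charpoly_smul_tensor g x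
  rw [h, hsq, hsq] at h1
  obtain ⟨π, hπ⟩ := exists_perm_of_prod_X_sub_C_eq h1.symm
  have h2 := det_smul_tensor g x
  rw [h, det_cartan, det_cartan] at h2
  have hs : ∀ i, ∃ s : ℤˣ, coord y (π i) = ((s : ℤ) : ℂ) * coord x i := by
    intro i
    rcases mul_self_eq_mul_self_iff.mp (hπ i) with h | h
    · exact ⟨1, by simpa using h⟩
    · exact ⟨-1, by simpa using h⟩
  choose s hs using hs
  have of_even : ∀ s : Fin 4 → ℤˣ, (∀ i, coord y (π i) = ((s i : ℤ) : ℂ) * coord x i) →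
      ∏ i, s i = 1 → ∃ w ∈ weyl, w x = y := by
    intro s hs hprod
    refine ⟨signedPerm π s, evenSigned_eq_weyl ▸ ⟨π, s, hprod, rfl⟩, ?_⟩
    apply coord.injective
    ext i
    obtain ⟨i, rfl⟩ := π.surjective i
    rw [coord_signedPerm, hs]
  by_cases hx : ∏ i, coord x i = 0
  · obtain ⟨i, -, hi⟩ := Finset.prod_eq_zero_iff.mp hx
    -- The sign at a vanishing coordinate is arbitrary, so it is used to correct the parity.
    refine of_even (fun j => if j = i then s j * ∏ k, s k else s j) ?_ ?_
    · intro j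
      rw [hs]
      split_ifs with hj
      · rw [hj, hi, mul_zero, mul_zero]
      · rfl
    · have hfac : ∀ j, (if j = i then s j * ∏ k, s k else s j) =
          s j * if j = i then ∏ k, s k else 1 := by
        intro j; split_ifs <;> simp
      simp only [hfac, Finset.prod_mul_distrib, Finset.prod_ite_eq', Finset.mem_univ, if_true]
      exact Int.units_mul_self _
  · refine of_even s hs ?_
    -- With no vanishing coordinate, invariance of the determinant forces the product of the signs
    -- to be 1.
    rw [← Equiv.prod_comp π] at h2
    simp only [hs, Finset.prod_mul_distrib] at h2
    have h3 := (mul_eq_right₀ hx).mp h2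
    apply Units.ext
    push_cast
    exact_mod_cast h3

/-! ### Hilbert 90 for `SL(2,ℂ)` -/

/-- Since `N'` is the inverse of `N`, each averaged matrix `Y = z + z̄ N'` satisfies `Ȳ = Y N`. It
remains to choose `z` with `Y` invertible and to normalise the determinant. -/
theorem exists_inv_mul_conj_eq {n : Matrix.SpecialLinearGroup (Fin 2) ℂ}
    (hn : n * Matrix.SpecialLinearGroup.map (starRingEnd ℂ) n = 1) :
    ∃ g : Matrix.SpecialLinearGroup (Fin 2) ℂ,
      g⁻¹ * Matrix.SpecialLinearGroup.map (starRingEnd ℂ) g = n := by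
  set N : Matrix (Fin 2) (Fin 2) ℂ := n.1 with hN
  set N' : Matrix (Fin 2) (Fin 2) ℂ := N.map (starRingEnd ℂ) with hN'
  have h1 : N' * N = 1 := mul_eq_one_comm.mp (congrArg Subtype.val hn)
  have hdet : N.det = 1 := n.2
  have hdet' : N'.det = 1 := by
    have := congrArg Matrix.det h1
    rwa [Matrix.det_mul, hdet, mul_one, Matrix.det_one] at this
  have hN'' : N'.map (starRingEnd ℂ) = N := by ext i j; simp [hN']
  have hconj : ∀ z : ℂ, (z • (1 : Matrix (Fin 2) (Fin 2) ℂ) +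
      starRingEnd ℂ z • N').map (starRingEnd ℂ) =
        (z • (1 : Matrix (Fin 2) (Fin 2) ℂ) + starRingEnd ℂ z • N') * N := by
    intro z
    rw [Matrix.add_mul, Matrix.smul_mul, Matrix.smul_mul, h1, Matrix.one_mul]
    conv_rhs => rw [← hN'']
    ext i j
    by_cases hij : i = j <;> simp [hij, add_comm]
  obtain ⟨Y, hY, hYdet⟩ : ∃ Y : Matrix (Fin 2) (Fin 2) ℂ,
      Y.map (starRingEnd ℂ) = Y * N ∧ Y.det ≠ 0 := by
    rw [Matrix.det_fin_two] at hdet'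
    by_cases htr : 2 + N'.trace = 0
    -- For `z = 1` the determinant is 2 + tr N'. If this is zero, `z = i` gives -det(1 - N') = -(2 -
    -- tr N') = -4.
    · refine ⟨_, hconj Complex.I, ?_⟩
      have : (Complex.I • (1 : Matrix (Fin 2) (Fin 2) ℂ) +
          starRingEnd ℂ Complex.I • N').det = -4 := by
        rw [Matrix.trace_fin_two] at htr
        rw [Matrix.det_fin_two]
        simp
        linear_combination (1 - N' 0 0 - N' 1 1 + N' 0 0 * N' 1 1 - N' 0 1 * N' 1 0) *
          Complex.I_sq - hdet' + htr
      rw [this]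
      norm_num
    · refine ⟨_, hconj 1, ?_⟩
      have : ((1 : ℂ) • (1 : Matrix (Fin 2) (Fin 2) ℂ) +
          starRingEnd ℂ (1 : ℂ) • N').det = 2 + N'.trace := by
        rw [Matrix.trace_fin_two]
        rw [Matrix.det_fin_two]
        simp
        linear_combination hdet'
      rwa [this]
  have hreal : starRingEnd ℂ Y.det = Y.det := by
    have h := congrArg Matrix.det hY
    rw [Matrix.det_mul, hdet, mul_one] at h
    rw [RingHom.map_det]
    exact h
  -- As det Y is real, scaling one row by its inverse is a real operation: it preserves `Ȳ = Y N`
  -- and makes the determinant 1.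
  set R : Matrix (Fin 2) (Fin 2) ℂ := !![Y.det⁻¹, 0; 0, 1] with hR
  have hRmap : R.map (starRingEnd ℂ) = R := by
    ext i j
    fin_cases i <;> fin_cases j <;> simp [hR, hreal]
  let g : Matrix.SpecialLinearGroup (Fin 2) ℂ :=
    ⟨R * Y, by rw [Matrix.det_mul, hR, Matrix.det_fin_two_of]; simp [hYdet]⟩
  refine ⟨g, ?_⟩
  rw [inv_mul_eq_iff_eq_mul]
  apply Subtype.ext
  change (R * Y).map (starRingEnd ℂ) = R * Y * N
  rw [Matrix.map_mul, hRmap, hY, Matrix.mul_assoc]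

theorem exists_inv_mul_conjG_eq {n : GHat} (hn : n ∈ Z1 conjG) :
    ∃ g : GHat, g⁻¹ * conjG g = n := by
  have h : ∀ i, ∃ g : Matrix.SpecialLinearGroup (Fin 2) ℂ,
      g⁻¹ * Matrix.SpecialLinearGroup.map (starRingEnd ℂ) g = n i :=
    fun i => exists_inv_mul_conj_eq (congrFun hn i)
  choose g hg using h
  exact ⟨g, funext hg⟩

theorem conjV_smul_tensor (g : GHat) (x : Tensor4) : conjV (g • x) = conjG g • conjV x := by
  ext ⟨i₁, i₂⟩ ⟨i₃, i₄⟩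
  rw [smul_apply]
  simp only [conjV, Matrix.map_apply, smul_apply, map_sum, map_mul]
  rfl

/-! ### The action of `Γ_Π` on the component -/

/-- At a regular point all vanishing roots lie in `P`, so the stabiliser in W is contained in W_Π,
whichever point is taken. Freeness of Γ_Π on 𝒞 rests on this. -/
theorem mem_weylSub_of_mem_hReg {P : Set (Module.Dual ℂ cartan)} {x : hSub P} (hx : x ∈ hReg P)
    {w : cartan ≃ₗ[ℂ] cartan} (hw : w ∈ weyl) (hwx : w (x : cartan) = x) : w ∈ weylSub P := by
  refine mem_weylSub_of_fixes (x := (x : cartan)) (fun α hα h => ?_) (weyl_le_evenSigned hw) hwx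
  by_contra hP
  exact hx α ⟨hα, hP⟩ h

/-- W_Π is the stabiliser in W of `x` and also of `y = w x`, and conjugation by `w` carries the
first stabiliser to the second. -/
theorem mem_weylNormalizer {P : Set (Module.Dual ℂ cartan)} (hP : P ⊆ roots) {x y : hSub P}
    (hx : x ∈ hReg P) (hy : y ∈ hReg P) {w : cartan ≃ₗ[ℂ] cartan} (hw : w ∈ weyl)
    (hwx : w (x : cartan) = y) : w ∈ weylNormalizer P := by
  have hle : weylSub P ≤ weyl := weylSub_mono hP
  have hwy : w⁻¹ (y : cartan) = x := by rw [← hwx]; exact w.symm_apply_apply _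
  refine ⟨hw, Subgroup.mem_normalizer_iff.mpr fun v => ⟨fun hv => ?_, fun hv => ?_⟩⟩
  · refine mem_weylSub_of_mem_hReg hy (mul_mem (mul_mem hw (hle hv)) (inv_mem hw)) ?_
    rw [LinearEquiv.mul_apply, LinearEquiv.mul_apply, hwy, weylSub_fixes hv x.2, hwx]
  · have hv' : v = w⁻¹ * (w * v * w⁻¹) * w := by group
    rw [hv']
    refine mem_weylSub_of_mem_hReg hx (mul_mem (mul_mem (inv_mem hw) (hle hv)) hw) ?_
    rw [LinearEquiv.mul_apply, LinearEquiv.mul_apply, hwx, weylSub_fixes hv y.2, hwy]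

/-- A reflection with respect to a root fixes exactly the kernel of the root. -/
theorem exists_reflection {α : Module.Dual ℂ cartan} (hα : α ∈ roots) :
    ∃ s : cartan ≃ₗ[ℂ] cartan, (∀ P : Set (Module.Dual ℂ cartan), α ∈ P → s ∈ weylSub P) ∧
      ∀ p, s p = p ↔ α p = 0 := by
  obtain ⟨i, j, hij, rfl⟩ := exists_of_mem_roots hα
  have h := isCoroot hij
  refine ⟨swapRefl i.1 j.1 (-(i.2 * j.2)), fun P hP =>
    Subgroup.subset_closure ⟨_, hP, _, h, swapRefl_eq hij⟩, fun p => ?_⟩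
  have hc : coord.symm (corootVec i j) ≠ 0 := by
    intro h0
    have := h.1
    rw [h0, map_zero] at this
    norm_num at this
  rw [swapRefl_eq hij, sub_eq_self, smul_eq_zero, or_iff_left hc]

/-- A root vanishes at `w x` iff its reflection `s` fixes `w x`, that is, iff `w⁻¹ s w` fixes `x`.
For a regular `x` this means that `w⁻¹ s w`, and hence `s`, lies in W_Π. -/
theorem weylNormalizer_mem_hReg {P : Set (Module.Dual ℂ cartan)} (hP : P ⊆ roots)
    {w : cartan ≃ₗ[ℂ] cartan} (hw : w ∈ weylNormalizer P) {x : hSub P} (hx : x ∈ hReg P) :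
    ∃ y ∈ hReg P, (y : cartan) = w (x : cartan) := by
  have hnorm := Subgroup.mem_normalizer_iff''.mp hw.2
  have hinv : ∀ v : cartan ≃ₗ[ℂ] cartan,
      (w⁻¹ * v * w) (x : cartan) = x ↔ v (w (x : cartan)) = w (x : cartan) := by
    intro v
    rw [LinearEquiv.mul_apply, LinearEquiv.mul_apply]
    exact w.symm_apply_eq
  have hmem : w (x : cartan) ∈ hSub P := by
    intro α hα
    obtain ⟨s, hs, hfix⟩ := exists_reflection (hP hα)
    rw [← hfix, ← hinv]
    exact weylSub_fixes ((hnorm s).mp (hs P hα)) x.2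
  refine ⟨⟨_, hmem⟩, fun α hα h0 => ?_, rfl⟩
  obtain ⟨s, hs, hfix⟩ := exists_reflection hα.1
  have h1 : w⁻¹ * s * w ∈ weyl := mul_mem (mul_mem (inv_mem hw.1) (hs _ hα.1)) hw.1
  have h2 := mem_weylSub_of_mem_hReg hx h1 ((hinv s).mpr ((hfix _).mpr h0))
  exact hx α hα ((hfix _).mp (weylSub_fixes ((hnorm s).mpr h2) x.2))

theorem gamAct_mk {P : Set (Module.Dual ℂ cartan)} (w : weylNormalizer P) (x : hSub P) :
    gamAct (QuotientGroup.mk w : Gam P) x = w.1 (x : cartan) := rfl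

theorem gamAct_one {P : Set (Module.Dual ℂ cartan)} (x : hSub P) : gamAct (1 : Gam P) x = x := rfl

theorem gamAct_mul {P : Set (Module.Dual ℂ cartan)} (a b : Gam P) {x y : hSub P}
    (h : (y : cartan) = gamAct b x) : gamAct (a * b) x = gamAct a y := by
  induction a using QuotientGroup.induction_on with | _ v
  induction b using QuotientGroup.induction_on with | _ w
  rw [← QuotientGroup.mk_mul, gamAct_mk, gamAct_mk, h, gamAct_mk]
  rfl

theorem gamAct_injective {P : Set (Module.Dual ℂ cartan)} {x : hSub P} (hx : x ∈ hReg P)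
    {a b : Gam P} (h : gamAct a x = gamAct b x) : a = b := by
  induction a using QuotientGroup.induction_on with | _ v
  induction b using QuotientGroup.induction_on with | _ w
  rw [gamAct_mk, gamAct_mk] at h
  rw [QuotientGroup.eq, Subgroup.mem_subgroupOf]
  refine mem_weylSub_of_mem_hReg hx (mul_mem (inv_mem v.2.1) w.2.1) ?_
  change v.1.symm (w.1 (x : cartan)) = x
  rw [← h, LinearEquiv.symm_apply_apply]

theorem exists_eq_gamAct {P : Set (Module.Dual ℂ cartan)} (hP : P ⊆ roots) (a : Gam P)
    {x : hSub P} (hx : x ∈ hReg P) : ∃ y ∈ hReg P, (y : cartan) = gamAct a x := by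
  induction a using QuotientGroup.induction_on with | _ v
  exact weylNormalizer_mem_hReg hP v.2 hx

theorem conjH_gamAct {P : Set (Module.Dual ℂ cartan)} (a : Gam P) {x y : hSub P}
    (h : (y : cartan) = conjH x) : conjH (gamAct a x) = gamAct (conjGam P a) y := by
  induction a using QuotientGroup.induction_on with | _ v
  change _ = conjGL v.1 (y : cartan)
  rw [gamAct_mk, conjGL_apply, h, conjH_conjH]

/-- By `dual_conj` the roots commute with complex conjugation, so the same roots vanish at `x` and
at its conjugate. -/
theorem exists_eq_conjH {P : Set (Module.Dual ℂ cartan)} (hP : P ⊆ roots) {x : hSub P}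
    (hx : x ∈ hReg P) : ∃ y ∈ hReg P, (y : cartan) = conjH x := by
  refine ⟨⟨conjH x, fun α hα => ?_⟩, fun α hα => ?_, rfl⟩
  · rw [dual_conj (hP hα).2, x.2 α hα, map_zero]
  · rw [Ne, dual_conj hα.1.2, map_eq_zero]
    exact hx α hα

theorem gamAct_mem_orbit {P : Set (Module.Dual ℂ cartan)} (a : Gam P) (x : hSub P) :
    ∃ g : GHat, (gamAct a x : Tensor4) = g • ((x : cartan) : Tensor4) := by
  induction a using QuotientGroup.induction_on with | _ v
  obtain ⟨g, hg⟩ := weyl_le_realised v.2.1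
  exact ⟨g, hg x⟩

/-! ### The action of the normaliser of the component -/

theorem exists_weylNormalizer_of_smul_eq {P : Set (Module.Dual ℂ cartan)} (hP : P ⊆ roots)
    {x y : hSub P} (hx : x ∈ hReg P) (hy : y ∈ hReg P) {g : GHat}
    (h : g • ((x : cartan) : Tensor4) = (y : cartan)) :
    ∃ w : weylNormalizer P, w.1 (x : cartan) = y := by
  obtain ⟨w, hw, hwx⟩ := exists_mem_weyl_of_smul_eq h
  exact ⟨⟨w, mem_weylNormalizer hP hx hy hw hwx⟩, hwx⟩

/-- The subspace of `𝔥_Π` on which `w` and `g` agree. -/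
def agreeSub (P : Set (Module.Dual ℂ cartan)) (g : GHat) (w : cartan ≃ₗ[ℂ] cartan) :
    Submodule ℂ (hSub P) where
  carrier := {x | g • ((x : cartan) : Tensor4) = (w (x : cartan) : Tensor4)}
  add_mem' := by
    intro x y hx hy
    change g • (((x : cartan) : Tensor4) + ((y : cartan) : Tensor4)) =
      ((w ((x : cartan) + (y : cartan)) : cartan) : Tensor4)
    rw [map_add, Submodule.coe_add, ← hx, ← hy]
    simp only [smul_def, Matrix.mul_add, Matrix.add_mul]
  zero_mem' := by
    change g • (0 : Tensor4) = ((w 0 : cartan) : Tensor4)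
    rw [map_zero]
    simp [smul_def]
  smul_mem' := by
    intro c x hx
    change g • (c • ((x : cartan) : Tensor4)) = ((w (c • (x : cartan)) : cartan) : Tensor4)
    rw [map_smul, Submodule.coe_smul, ← hx]
    simp only [smul_def, Matrix.mul_smul, Matrix.smul_mul]

/-- A complex vector space is not a finite union of proper subspaces. 𝔥_Π is covered by the kernels
of the roots outside `P`, all proper because of `q`, and by the subspaces where `g` agrees with some
Weyl element. -/
theorem exists_agreeSub_eq_top {P : Set (Module.Dual ℂ cartan)} {q : hSub P} (hq : q ∈ hReg P)
    {g : GHat} (hg : g ∈ normC P) : ∃ w ∈ weyl, agreeSub P g w = ⊤ := by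
  have hfinR : Finite ↥(roots \ P) := (roots_finite.subset Set.sdiff_subset).to_subtype
  have hfinW : Finite weyl :=
    (evenSigned_finite.subset (fun w hw => weyl_le_evenSigned hw)).to_subtype
  let F : ↥(roots \ P) ⊕ weyl → Subspace ℂ (hSub P) := Sum.elim
    (fun α => LinearMap.ker (α.1 ∘ₗ (hSub P).subtype)) (fun w => agreeSub P g w.1)
  have hcov : ⋃ i, (F i : Set (hSub P)) = Set.univ := by
    refine Set.eq_univ_of_forall fun x => Set.mem_iUnion.mpr ?_
    by_cases hx : x ∈ hReg P
    · obtain ⟨y, -, hy⟩ := hg _ ⟨x, hx, rfl⟩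
      obtain ⟨w, hw, hwx⟩ := exists_mem_weyl_of_smul_eq (g := g) (x := (x : cartan))
        (y := (y : cartan)) hy.symm
      refine ⟨Sum.inr ⟨w, hw⟩, ?_⟩
      change g • ((x : cartan) : Tensor4) = (w (x : cartan) : Tensor4)
      rw [hwx]
      exact hy.symm
    · have hx : ¬ ∀ α ∈ roots \ P, α (x : cartan) ≠ 0 := hx
      push Not at hx
      obtain ⟨α, hα, h0⟩ := hx
      exact ⟨Sum.inl ⟨α, hα⟩, h0⟩
  obtain ⟨α | w, h⟩ := Subspace.exists_eq_top_of_iUnion_eq_univ hcov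
  · exact absurd (h ▸ Submodule.mem_top : q ∈ F (Sum.inl α)) (hq α.1 α.2)
  · exact ⟨w.1, w.2, h⟩

/-- An element `g` of the normaliser acts on the whole component through `φ(g)`. -/
theorem smul_eq_gamAct_phi {P : Set (Module.Dual ℂ cartan)} (hP : P ⊆ roots) {q : hSub P}
    (hq : q ∈ hReg P) (g : normC P) (x : hSub P) :
    g.1 • ((x : cartan) : Tensor4) = (gamAct (phi q g) x : Tensor4) := by
  obtain ⟨w, hw, htop⟩ := exists_agreeSub_eq_top hq g.2
  have hagree : ∀ x : hSub P, g.1 • ((x : cartan) : Tensor4) = (w (x : cartan) : Tensor4) :=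
    fun x => (htop ▸ Submodule.mem_top : x ∈ agreeSub P g.1 w)
  obtain ⟨y, hy, hgq⟩ := g.2 _ ⟨q, hq, rfl⟩
  have hwq : w (q : cartan) = y := Subtype.ext ((hagree q).symm.trans hgq.symm)
  let w' : weylNormalizer P := ⟨w, mem_weylNormalizer hP hq hy hw hwq⟩
  -- The uniform `w'` shows that the choice defining `phi` is made from a nonempty set. The chosen
  -- element may differ from `w'`, but freeness at `q` gives the same coset.
  have hspec := Classical.epsilon_spec (p := fun w : weylNormalizer P =>
    ((w.1 (q : cartan) : cartan) : Tensor4) = g.1 • ((q : cartan) : Tensor4)) ⟨w', (hagree q).symm⟩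
  have hphi : phi q g = QuotientGroup.mk w' := by
    apply gamAct_injective hq
    apply Subtype.ext
    exact hspec.trans (hagree q)
  rw [hphi, gamAct_mk]
  exact hagree x

end FourQubit

end

/-! ### The criterion for real points -/

open FourQubit in
theorem theorem5p1
    -- a set `P` of roots, the component `𝔥_P°`, a base point `q` and a point `t` of it
    (P : Set (Module.Dual ℂ FourQubit.cartan)) (hP : P ⊆ FourQubit.roots)
    (q : FourQubit.hSub P) (hq : q ∈ FourQubit.hReg P)
    (t : FourQubit.Tensor4) (ht : t ∈ FourQubit.component P)
    -- cocycles representing all classes of `H¹(Γ_P)`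
    (s : ℕ) (γ : Fin s → FourQubit.Z1 (FourQubit.conjGam P))
    (hγ : Set.range (fun i => FourQubit.H1.mk (γ i)) = Set.univ)
    -- lifts of these to cocycles of `N(𝒞)`
    (n : Fin s → FourQubit.normC P)
    (hn : ∀ i, (n i : FourQubit.GHat) ∈ FourQubit.Z1 FourQubit.conjG)
    (hφ : ∀ i, FourQubit.phi q (n i) = (γ i : FourQubit.Gam P)) :
    ((∃ p ∈ MulAction.orbit FourQubit.GHat t, FourQubit.conjV p = p) ↔
      ∃ q' ∈ FourQubit.hReg P,
        ((q' : FourQubit.cartan) : FourQubit.Tensor4) ∈ MulAction.orbit FourQubit.GHat t ∧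
        ∃ i, FourQubit.conjV ((q' : FourQubit.cartan) : FourQubit.Tensor4) =
          (FourQubit.gamAct (γ i : FourQubit.Gam P)⁻¹ q' : FourQubit.Tensor4)) ∧
    ∀ q' ∈ FourQubit.hReg P,
      ((q' : FourQubit.cartan) : FourQubit.Tensor4) ∈ MulAction.orbit FourQubit.GHat t →
      ∀ i, FourQubit.conjV ((q' : FourQubit.cartan) : FourQubit.Tensor4) =
          (FourQubit.gamAct (γ i : FourQubit.Gam P)⁻¹ q' : FourQubit.Tensor4) →
        (∃ g : FourQubit.GHat, g⁻¹ * FourQubit.conjG g = n i) ∧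
        ∀ g : FourQubit.GHat, g⁻¹ * FourQubit.conjG g = n i →
          g • ((q' : FourQubit.cartan) : FourQubit.Tensor4) ∈ MulAction.orbit FourQubit.GHat t ∧
          FourQubit.conjV (g • ((q' : FourQubit.cartan) : FourQubit.Tensor4)) =
            g • ((q' : FourQubit.cartan) : FourQubit.Tensor4) := by
  obtain ⟨t, ht, rfl⟩ := ht
  have hreal : ∀ q' ∈ hReg P, ∀ i, conjV ((q' : cartan) : Tensor4) =
      (gamAct (γ i : Gam P)⁻¹ q' : Tensor4) → ∀ g : GHat, g⁻¹ * conjG g = n i →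
        conjV (g • ((q' : cartan) : Tensor4)) = g • ((q' : cartan) : Tensor4) := by
    intro q' hq' i h g hg
    obtain ⟨y, -, hy⟩ := exists_eq_gamAct hP (γ i : Gam P)⁻¹ hq'
    have hg' : conjG g = g * (n i : GHat) := by rw [← hg, mul_inv_cancel_left]
    -- The computation is `conj (g q') = g n_i γ_i⁻¹ q' = g γ_i γ_i⁻¹ q' = g q'`.
    rw [conjV_smul_tensor, hg', mul_smul, h, ← hy, smul_eq_gamAct_phi hP hq, hφ,
      ← gamAct_mul _ _ hy, mul_inv_cancel, gamAct_one]
  refine ⟨⟨?_, ?_⟩, fun q' hq' horb i h => ⟨exists_inv_mul_conjG_eq (hn i), fun g hg => ⟨?_,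
    hreal q' hq' i h g hg⟩⟩⟩
  · rintro ⟨_, ⟨g, rfl⟩, hp⟩
    obtain ⟨t', ht', htt'⟩ := exists_eq_conjH hP ht
    have hgt : ((conjG g)⁻¹ * g) • ((t : cartan) : Tensor4) = (t' : cartan) := by
      rw [mul_smul, inv_smul_eq_iff, htt']
      have hp : conjV (g • ((t : cartan) : Tensor4)) = g • ((t : cartan) : Tensor4) := hp
      rw [conjV_smul_tensor] at hp
      exact hp.symm
    obtain ⟨w, hw⟩ := exists_weylNormalizer_of_smul_eq hP ht ht' hgt
    set c : Gam P := QuotientGroup.mk w with hc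
    have hct : (t' : cartan) = gamAct c t := hw.symm
    -- Conjugating `t' = c t` gives `t = c̄ t' = c̄ c t`, and the action is free at `t`.
    have hcc : conjGam P c * c = 1 := by
      apply gamAct_injective ht
      rw [gamAct_mul _ _ hct, ← conjH_gamAct c htt', ← hct, htt', conjH_conjH, gamAct_one]
    have hz : c⁻¹ ∈ Z1 (conjGam P) := by
      change c⁻¹ * conjGam P c⁻¹ = 1
      rw [map_inv, ← mul_inv_rev, hcc, inv_one]
    obtain ⟨i, hi⟩ : H1.mk ⟨c⁻¹, hz⟩ ∈ Set.range (fun i => H1.mk (γ i)) := hγ ▸ Set.mem_univ _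
    obtain ⟨a, ha⟩ := Quotient.exact hi
    have ha : c⁻¹ = a * (γ i : Gam P) * (conjGam P a)⁻¹ := ha
    -- With `q' = a⁻¹ t`, one has `conj q' = ā⁻¹ c t = (ā⁻¹ c a) q'`, and `ā⁻¹ c a` is `γ_i⁻¹` by
    -- the choice of `a`.
    obtain ⟨q', hq', hqt⟩ := exists_eq_gamAct hP a⁻¹ ht
    refine ⟨q', hq', ?_, i, ?_⟩
    · obtain ⟨h, hh⟩ := gamAct_mem_orbit a⁻¹ t
      exact ⟨h, by rw [hqt, hh]⟩
    · change ((conjH (q' : cartan) : cartan) : Tensor4) = _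
      rw [hqt, conjH_gamAct _ htt', ← gamAct_mul _ _ hct, ← gamAct_mul _ _ hqt]
      congr 2
      rw [← inv_inj, mul_inv_rev, ha, map_inv]
      group
  · rintro ⟨q', hq', horb, i, h⟩
    obtain ⟨g, hg⟩ := exists_inv_mul_conjG_eq (hn i)
    exact ⟨_, (MulAction.mem_orbit_iff.mp horb).elim fun k hk => ⟨g * k, by
      change (g * k) • _ = _
      rw [mul_smul, hk]⟩, hreal q' hq' i h g hg⟩
  · obtain ⟨k, hk⟩ := horb
    exact ⟨g * k, by
      change (g * k) • _ = _
      rw [mul_smul]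
      exact congrArg _ hk⟩
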